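/- \textbf{Setting.} There are $n\ge 1$ jobs; job $i$ has work $w_i>0$, release date $r_i$ and deadline $d_i>r_i$, and density $den_i=w_i/(d_i-r_i)$. There are $m\ge 1$ identical processors; a processor running at speed $s\ge 0$ consumes power $s^\alpha$, where $\alpha>1$. A schedule specifies (measurably) for each processor and each time the speed and the job being executed, if any. It is feasible if each job is executed only within $[r_i,d_i]$, never on two processors at the same time, and exactly $w_i$ units of job $i$ are processed; preemption and migration are allowed and speeds may vary arbitrarily. A feasible schedule is optimal if its total energy (the integral of the power, summed over the processors) is minimal among all feasible schedules. Let $t_0<\dots<t_L$ be the distinct release dates and deadlines, $I_j=[t_{j-1},t_j]$, and $A(j)$ the set of jobs $i$ with $I_j\subseteq[r_i,d_i]$. For a set $J$ of jobs, numbers $m_j$ of available processors in $I_j$ and a speed $v>0$, the work assignment problem (WAP) asks for a feasible schedule of $J$ that executes every job of $J$ always at speed $v$ and uses only $m_j$ processors in $I_j$. Its graph has edges (source, job $i$) of capacity $w_i/v$ for $i\in J$, (job $i$, $I_j$) of capacity $|I_j|$ for $i\in J\cap A(j)$, and ($I_j$, sink) of capacity $m_j|I_j|$. The critical speed is the minimum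 $v$ for which the WAP is feasible. At the critical speed, a job $i\in J$ is critical if in every feasible WAP schedule and every $I_j\subseteq[r_i,d_i]$, either job $i$ is executed during all of $I_j$, or all $m_j$ available processors are busy during all of $I_j$. \textbf{Algorithm BAL}, with accuracy $\delta>0$. Start with all jobs, $m_j=m$, and $s_{UB}=\max\{\max_j\sum_{i\in A(j)}w_i/|I_j|,\ \max_i den_i\}$. While jobs remain: (1) let $s_{LB}$ be the maximum density of a remaining job and find the critical speed $v$, by binary search between $s_{LB}$ and $s_{UB}$, each test being a maximum flow computation in the WAP graph; (2) choose any $v'\in(0,v)$ that is greater than the next critical speed (the critical speed of the instance from which the critical jobs have been removed, if jobs remain there), and take any minimum cut of the WAP graph for the speed $v'$; (3) give speed $s_i=v$ to the jobs $i$ on the source side of the cut and remove them; in each $I_j$ subtract from $m_j$ the number of removed jobs that are alive in $I_j$ (setting $m_j=0$ if the result would be negative); set $s_{UB}=v$. At the end, schedule each job with processing time $w_i/s_i$ at speed $s_i$ on the $m$ processors, by a maximum flow computation that gives the execution times in each $I_j$ and McNaughton's wrap-around rule in each $I_j$. Each iteration uses the exact critical speed $v$; its determination is charged the cost of the binary search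 over the multiples of $\delta$. \textbf{Theorem 1.} Algorithm BAL is well defined and terminates: as long as jobs remain, the critical speed exists and lies in $[s_{LB},s_{UB}]$, an iteration can be performed, and every iteration removes at least one job. The speed found by the binary search lies in $[v,v+\delta)$, and it equals $v$ if $v$ is a multiple of $\delta$. Whatever choices are made in (2), the output is an optimal schedule. Moreover there is an absolute constant $C$ such that, if the maximum flow subroutine takes time at most $f(n)$ on layered graphs (source, jobs, intervals, sink) with $n$ job vertices and at most $2n$ interval vertices, and $f(n)\ge n^2$, then the total running time (counting real arithmetic operations, comparisons, and the time of the subroutine) is at most $C\,n\,f(n)\log(2+P)$, where $P=(s_{UB}-\min_i den_i)/\delta$ with the initial $s_{UB}$. -/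

import Mathlib

open MeasureTheory

noncomputable section

namespace BAL

/-! ### Jobs and schedules -/

/-- A set of `n` jobs; job `i` has work `w i > 0`, release date `r i` and deadline `d i > r i`. -/
structure Jobs (n : ℕ) where
  w : Fin n → ℝ
  r : Fin n → ℝ
  d : Fin n → ℝ
  w_pos : ∀ i, 0 < w i
  r_lt_d : ∀ i, r i < d i

/-- A schedule on `m` processors: at time `t`, processor `p` runs at speed `speed p t` and executes
the job `job p t` (`none` when no job is executed). Preemption and migration are unrestricted. -/
structure Schedule (n m : ℕ) where
  job : Fin m → ℝ → Option (Fin n)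
  speed : Fin m → ℝ → ℝ

namespace Schedule

variable {n m : ℕ}

/-- The times at which processor `p` executes job `i`. -/
def runs (σ : Schedule n m) (p : Fin m) (i : Fin n) : Set ℝ := {t | σ.job p t = some i}

/-- The total time during which job `i` is executed within the set of times `A`. -/
def procTime (σ : Schedule n m) (i : Fin n) (A : Set ℝ) : ℝ :=
  ∑ p, (volume (σ.runs p i ∩ A)).toReal

/-- The amount of work of job `i` that is processed. -/
def workDone (σ : Schedule n m) (i : Fin n) : ENNReal :=
  ∑ p, ∫⁻ t in σ.runs p i, ENNReal.ofReal (σ.speed p t)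

/-- The total energy consumed by all processors, for the power function `s ^ α`. -/
def energy (σ : Schedule n m) (α : ℝ) : ENNReal :=
  ∑ p, ∫⁻ t, ENNReal.ofReal (σ.speed p t ^ α)

/-- The conditions on a schedule that do not concern the amounts of work: measurability,
nonnegative speeds, no job is run by two processors at the same time, and every job is run only
between its release date and its deadline. -/
structure Valid (σ : Schedule n m) (I : Jobs n) : Prop where
  measurable_runs : ∀ p i, MeasurableSet (σ.runs p i)
  measurable_speed : ∀ p, Measurable (σ.speed p)
  speed_nonneg : ∀ p t, 0 ≤ σ.speed p t
  no_parallel : ∀ p q t i, σ.job p t = some i → σ.job q t = some i → p = q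
  in_span : ∀ p t i, σ.job p t = some i → t ∈ Set.Icc (I.r i) (I.d i)

/-- A feasible schedule: valid, and it completes every job. -/
def Feasible (σ : Schedule n m) (I : Jobs n) : Prop :=
  σ.Valid I ∧ ∀ i, σ.workDone i = ENNReal.ofReal (I.w i)

/-- An optimal schedule: feasible and of minimum energy among all feasible schedules. -/
def Optimal (σ : Schedule n m) (I : Jobs n) (α : ℝ) : Prop :=
  σ.Feasible I ∧ ∀ σ' : Schedule n m, σ'.Feasible I → σ.energy α ≤ σ'.energy α

end Schedule

namespace Jobs

variable {n : ℕ} (I : Jobs n)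

/-- The density of a job. -/
def den (i : Fin n) : ℝ := I.w i / (I.d i - I.r i)

/-- The set of all release dates and deadlines. -/
def times : Finset ℝ := Finset.univ.image I.r ∪ Finset.univ.image I.d

/-- The number of intervals between consecutive release dates or deadlines. -/
def L : ℕ := I.times.card - 1

/-- The left end point of the `j`-th interval. -/
def left (j : Fin I.L) : ℝ :=
  I.times.orderEmbOfFin rfl ⟨j, Nat.lt_of_lt_of_le j.2 (Nat.sub_le _ _)⟩

/-- The right end point of the `j`-th interval. -/
def right (j : Fin I.L) : ℝ :=
  I.times.orderEmbOfFin rfl ⟨j + 1, Nat.add_lt_of_lt_sub j.2⟩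

/-- The length of the `j`-th interval. -/
def len (j : Fin I.L) : ℝ := I.right j - I.left j

/-- Job `i` is alive during the `j`-th interval: the interval is contained in its span. -/
def Alive (i : Fin n) (j : Fin I.L) : Prop := I.r i ≤ I.left j ∧ I.right j ≤ I.d i

open Classical in
/-- The set of jobs that are alive during the `j`-th interval. -/
def aliveSet (j : Fin I.L) : Finset (Fin n) := Finset.univ.filter fun i => I.Alive i j

/-- The initial upper bound on the speeds. -/
def sUB : ℝ := max (⨆ j, (∑ i ∈ I.aliveSet j, I.w i) / I.len j) (⨆ i, I.den i)

end Jobs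

/-! ### Flows and cuts -/

section Flow

variable {V : Type} [Fintype V] [DecidableEq V]

/-- `f` is an `(s,t)`-flow with respect to the edge capacities `c`. -/
structure IsFlow (c : V → V → ℝ) (s t : V) (f : V → V → ℝ) : Prop where
  nonneg : ∀ u v, 0 ≤ f u v
  le_cap : ∀ u v, f u v ≤ c u v
  conserve : ∀ v, v ≠ s → v ≠ t → ∑ u, f u v = ∑ u, f v u

/-- The value of a flow with source `s`. -/
def flowValue (s : V) (f : V → V → ℝ) : ℝ := ∑ u, f s u - ∑ u, f u s

/-- `f` is a maximum `(s,t)`-flow. -/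
def IsMaxFlow (c : V → V → ℝ) (s t : V) (f : V → V → ℝ) : Prop :=
  IsFlow c s t f ∧ ∀ g, IsFlow c s t g → flowValue s g ≤ flowValue s f

/-- The capacity of the cut with source side `X`. -/
def cutCap (c : V → V → ℝ) (X : Finset V) : ℝ := ∑ u ∈ X, ∑ v ∈ Xᶜ, c u v

/-- `X` is the source side of a minimum `(s,t)`-cut. -/
def IsMinCut (c : V → V → ℝ) (s t : V) (X : Finset V) : Prop :=
  s ∈ X ∧ t ∉ X ∧ ∀ Y : Finset V, s ∈ Y → t ∉ Y → cutCap c X ≤ cutCap c Y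

end Flow

/-- The vertices of the layered graphs: source, jobs, intervals, sink. -/
inductive Node (n L : ℕ) : Type
  | src : Node n L
  | job (i : Fin n) : Node n L
  | itv (j : Fin L) : Node n L
  | snk : Node n L
  deriving DecidableEq, Fintype

/-- Capacities of a layered graph (source - jobs - intervals - sink); an absent edge has
capacity `0`. -/
structure Net (n L : ℕ) where
  supply : Fin n → ℝ
  link : Fin n → Fin L → ℝ
  drain : Fin L → ℝ

namespace Net

variable {n L : ℕ}

/-- All capacities are nonnegative. -/
def Nonneg (N : Net n L) : Prop :=
  (∀ i, 0 ≤ N.supply i) ∧ (∀ i j, 0 ≤ N.link i j) ∧ ∀ j, 0 ≤ N.drain j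

/-- The capacity function on pairs of vertices. -/
def cap (N : Net n L) : Node n L → Node n L → ℝ
  | .src, .job i => N.supply i
  | .job i, .itv j => N.link i j
  | .itv j, .snk => N.drain j
  | _, _ => 0

end Net

/-- The number of capacities of a layered graph. -/
def graphSize (n L : ℕ) : ℕ := n + n * L + L

/-- A maximum flow subroutine for layered graphs, together with its running time on each input. -/
structure MaxFlowAlg where
  flow : ∀ {n L : ℕ}, Net n L → Node n L → Node n L → ℝ
  time : ∀ {n L : ℕ}, Net n L → ℕ
  correct : ∀ {n L : ℕ} (N : Net n L), N.Nonneg → IsMaxFlow N.cap .src .snk (flow N)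

/-- `F` computes a maximum flow in time at most `f n` on layered graphs with `n` job vertices and at
most `2 n` interval vertices. -/
def MaxFlowAlg.RunsIn (F : MaxFlowAlg) (f : ℕ → ℕ) : Prop :=
  ∀ (n L : ℕ) (N : Net n L), N.Nonneg → L ≤ 2 * n → F.time N ≤ f n

/-! ### The work assignment problem and the states of the algorithm -/

/-- A state of the algorithm: the jobs that remain, the number of processors that are available in
each interval, the speeds assigned so far, and the current upper bound on the speeds. -/
structure State {n : ℕ} (I : Jobs n) where
  jobs : Finset (Fin n)
  mach : Fin I.L → ℕ
  speed : Fin n → ℝ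
  ub : ℝ

/-- The initial state: all jobs, `m` processors in every interval, no speed assigned. -/
def init {n : ℕ} (I : Jobs n) (m : ℕ) : State I where
  jobs := Finset.univ
  mach _ := m
  speed _ := 0
  ub := I.sUB

namespace State

variable {n : ℕ} {I : Jobs n}

/-- The lower bound on the next speed: the maximum density of a remaining job. -/
def lb (S : State I) : ℝ := sSup (I.den '' (S.jobs : Set (Fin n)))

/-- `σ` is a feasible schedule for the work assignment problem given by the remaining jobs, the
available processors and the speed `v`: it executes exactly the remaining jobs, always at speed `v`,
and during the `j`-th interval it uses only the `S.mach j` available processors (those with the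
smallest numbers). -/
structure WapSchedule (S : State I) {m : ℕ} (v : ℝ) (σ : Schedule n m) : Prop where
  valid : σ.Valid I
  mem_jobs : ∀ p t i, σ.job p t = some i → i ∈ S.jobs
  speed_eq : ∀ p t i, σ.job p t = some i → σ.speed p t = v
  avail : ∀ j p t i, t ∈ Set.Ioo (I.left j) (I.right j) → σ.job p t = some i → (p : ℕ) < S.mach j
  work : ∀ i ∈ S.jobs, σ.workDone i = ENNReal.ofReal (I.w i)

/-- `v` is the critical speed of the current instance of the work assignment problem: the minimum
speed for which the instance is feasible. -/
def IsCritSpeed (m : ℕ) (S : State I) (v : ℝ) : Prop :=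
  IsLeast {v : ℝ | 0 < v ∧ ∃ σ : Schedule n m, S.WapSchedule v σ} v

/-- Job `i` is critical for the instance with speed `v`: in every feasible schedule and every
interval in which job `i` is alive, either job `i` is executed during the whole interval or all
available processors are busy during the whole interval. -/
def IsCritJob (m : ℕ) (S : State I) (v : ℝ) (i : Fin n) : Prop :=
  ∀ σ : Schedule n m, S.WapSchedule v σ → ∀ j, I.Alive i j →
    σ.procTime i (Set.Icc (I.left j) (I.right j)) = I.len j ∨
    ∑ k, σ.procTime k (Set.Icc (I.left j) (I.right j)) = S.mach j * I.len j

open Classical in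
/-- The set of critical jobs. -/
def critJobs (m : ℕ) (S : State I) (v : ℝ) : Finset (Fin n) :=
  S.jobs.filter fun i => S.IsCritJob m v i

open Classical in
/-- Assign speed `v` to the jobs in `C`, remove them, and update the numbers of available
processors and the upper bound. In each interval the removed jobs that are alive occupy one
processor each, or all the available ones if there are not enough of them (the subtraction of
natural numbers is truncated at `0` on purpose). -/
def remove (S : State I) (C : Finset (Fin n)) (v : ℝ) : State I where
  jobs := S.jobs \ C
  mach j := S.mach j - (C ∩ I.aliveSet j).card
  speed i := if i ∈ C then v else S.speed i
  ub := v

open Classical in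
/-- The layered graph of the current instance of the work assignment problem with speed `v`. -/
def net (S : State I) (v : ℝ) : Net n I.L where
  supply i := if i ∈ S.jobs then I.w i / v else 0
  link i j := if i ∈ S.jobs ∧ I.Alive i j then I.len j else 0
  drain j := S.mach j * I.len j

end State

/-! ### The algorithm, with its running time

Running times count arithmetic operations and comparisons of reals, reading or writing of one
number, and the time of the maximum flow subroutine. -/

/-- Binary search for the least `k` with `a ≤ k ≤ b` that passes the test, when `b` is known to
pass. A test returns its outcome and its running time. Returns `k` and the time spent. -/
def bisect (test : ℕ → Bool × ℕ) (a b : ℕ) : ℕ × ℕ :=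
  if a < b then
    if (test ((a + b) / 2)).1 then
      let res := bisect test a ((a + b) / 2)
      (res.1, (test ((a + b) / 2)).2 + 4 + res.2)
    else
      let res := bisect test ((a + b) / 2 + 1) b
      (res.1, (test ((a + b) / 2)).2 + 4 + res.2)
  else (b, 1)
termination_by b - a
decreasing_by all_goals omega

section Algorithm

variable (F : MaxFlowAlg) {n : ℕ} {I : Jobs n}

open Classical in
/-- The feasibility test for speed `v`: build the layered graph, compute a maximum flow and check
whether its value is the total capacity of the edges that leave the source. -/
def wapTest (S : State I) (v : ℝ) : Bool × ℕ :=
  (decide (flowValue .src (F.flow (S.net v)) = ∑ i, (S.net v).supply i),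
    graphSize n I.L + F.time (S.net v) + 2 * n)

/-- The binary search for the critical speed among the multiples of the accuracy `δ`, between the
current lower and upper bounds. Returns the speed found and the time spent. -/
def search (δ : ℝ) (S : State I) : ℝ × ℕ :=
  let res := bisect (fun k => wapTest F S (k * δ)) ⌈S.lb / δ⌉₊ ⌈S.ub / δ⌉₊
  (res.1 * δ, res.2 + 4)

open Classical in
/-- One iteration of the while loop, leading from `S` to `S'` in time `c`. The critical speed `v` is
determined, the search for it being charged the cost of the binary search with accuracy `δ`. Then a
minimum cut `X` is computed (any one, by a maximum flow computation followed by a breadth-first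
search) in the graph for some speed `v'` smaller than `v` and greater than the next critical speed;
the jobs on the source side of the cut are assigned speed `v` and removed. -/
def Step (m : ℕ) (δ : ℝ) (S S' : State I) (c : ℕ) : Prop :=
  S.jobs.Nonempty ∧ ∃ (v v' : ℝ) (X : Finset (Node n I.L)),
    S.IsCritSpeed m v ∧
    0 < v' ∧ v' < v ∧ (∀ u, (S.remove (S.critJobs m v) v).IsCritSpeed m u → u < v') ∧
    IsMinCut (S.net v').cap .src .snk X ∧
    S' = S.remove (S.jobs.filter fun i => Node.job i ∈ X) v ∧
    c = (search F δ S).2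
      + (graphSize n I.L + F.time (S.net v') + 2 * graphSize n I.L + (n + I.L + 2))
      + (2 * n + n * I.L + I.L) + n

/-- `Run F m δ S S' c`: finitely many iterations lead from `S` to `S'`, in total time `c`. -/
inductive Run (m : ℕ) (δ : ℝ) : State I → State I → ℕ → Prop
  | refl (S : State I) : Run m δ S S 0
  | tail {S S' S'' : State I} {c c' : ℕ} :
      Run m δ S S' c → Step F m δ S' S'' c' → Run m δ S S'' (c + c')

/-- The time for sorting the release dates and deadlines, for finding the jobs that are alive in
each interval, and for computing the initial bounds. -/
def initTime (I : Jobs n) : ℕ := (2 * n) * (2 * n) + 2 * (n * I.L) + (n * I.L + I.L) + 4 * n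

open Classical in
/-- The layered graph for preemptive scheduling on `m` identical processors with release dates,
deadlines and processing times `w i / s i`. -/
def finalNet (I : Jobs n) (m : ℕ) (s : Fin n → ℝ) : Net n I.L where
  supply i := I.w i / s i
  link i j := if I.Alive i j then I.len j else 0
  drain j := m * I.len j

open Classical in
/-- McNaughton's wrap-around rule: in the `j`-th interval the execution times `τ i j` are laid one
after the other on a line that is cut into pieces of the length of the interval, and the `p`-th piece
is executed by processor `p`. Job `i` is executed at speed `s i`. -/
def wrapAround (I : Jobs n) (m : ℕ) (τ : Fin n → Fin I.L → ℝ) (s : Fin n → ℝ) : Schedule n m :=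
  let job : Fin m → ℝ → Option (Fin n) := fun p t =>
    if h : ∃ i, ∃ j, t ∈ Set.Ico (I.left j) (I.right j) ∧
        (p : ℕ) * I.len j + (t - I.left j) ∈
          Set.Ico (∑ k ∈ Finset.Iio i, τ k j) (∑ k ∈ Finset.Iic i, τ k j)
    then some h.choose else none
  { job := job
    speed := fun p t => match job p t with
      | some i => s i
      | none => 0 }

/-- The last line of the algorithm: schedule each job with processing time `w i / s i`, by a maximum
flow computation, which gives the execution times in each interval, and the wrap-around rule in each
interval. -/
def output (m : ℕ) (S : State I) : Schedule n m :=
  wrapAround I m (fun i j => F.flow (finalNet I m S.speed) (.job i) (.itv j)) S.speed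

/-- The time for computing the output; the wrap-around rule produces at most two pieces per job and
interval. -/
def outputTime (m : ℕ) (S : State I) : ℕ :=
  graphSize n I.L + F.time (finalNet I m S.speed) + n + 4 * (n * I.L) + I.L

/-- The number `P`: the length of the range of all possible speeds, from the minimum density to the
initial upper bound, divided by the accuracy. -/
def speedRange (I : Jobs n) (δ : ℝ) : ℝ := (I.sUB - ⨅ i, I.den i) / δ

end Algorithm

end BAL

end

/-!
The proof rests on the polymatroid of execution times. For numbers `mach j` of available processors,
the `rank` of a set `A` of jobs is the total time `∑ j, len j * min (mach j) |A ∩ aliveSet j|` that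
the jobs of `A` can be executed. By McNaughton's wrap-around rule (`Fits.wrapAround_valid`,
`Fits.wrapAround_workDone`) and its converse (`Schedule.Valid.fits`), schedules correspond to
execution times per job and interval, which are the saturating flows of a layered network. Hence, by
max-flow min-cut, the work assignment problem with speed `v` is feasible iff every set `A` of
remaining jobs satisfies `∑ i ∈ A, w i ≤ v * rank A` (`State.Loaded`,
`State.exists_wapSchedule_iff`), so that the critical speed is the maximum of the ratios of work to
rank.

The rank is submodular, so at the critical speed there is a largest set for which equality holds, and
it is the set of critical jobs (`State.IsMaxTight.critJobs_eq`): a job outside of it tolerates a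
slight increase of its work. The cuts of the network for a speed `v'` amount to the function
`A ↦ v' * rank A - ∑ i ∈ A, w i`, and for `v'` between the next and the current critical speed the
set of critical jobs is its only minimizer (`State.IsCritSpeed.cut_jobs_eq`). Thus the choices made
in an iteration do not matter. Removing the critical jobs contracts the polymatroid
(`rank_contract`), and the next critical speed is strictly smaller.

At the end, the execution times `w i / speed i` lie in the polymatroid and, since they fill the rank
of every union of consecutively removed sets while the speeds decrease, they maximize the linear
function with weights `speed i ^ α` over the polymatroid (`Invariant`). For optimality, the energy of
any feasible schedule is bounded from below by replacing `y ↦ y ^ α` by its tangent at `speed i`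
during the execution of job `i` (`Schedule.Feasible.le_energy`). This bound is affine in the execution
times, with weights proportional to `-speed i ^ α`, and is therefore least at the execution times of
the output, where it is the energy of the output.

For the running time, each iteration removes a job, and its binary search starts with a range of
length at most `P + 1` that is halved by each test.
-/

open MeasureTheory

noncomputable section

namespace BAL

/-! ### Maximum flows and minimum cuts -/

section Flow

variable {V : Type} [Fintype V]

/-- The net amount that leaves the vertex `v`. -/
def netOut (f : V → V → ℝ) (v : V) : ℝ := ∑ u, f v u - ∑ u, f u v

variable [DecidableEq V] {c : V → V → ℝ} {s t : V} {f : V → V → ℝ}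

lemma sum_netOut (f : V → V → ℝ) (X : Finset V) :
    ∑ v ∈ X, netOut f v = ∑ u ∈ X, ∑ v ∈ Xᶜ, f u v - ∑ u ∈ X, ∑ v ∈ Xᶜ, f v u := by
  have h1 : ∀ u, ∑ v, f u v = ∑ v ∈ X, f u v + ∑ v ∈ Xᶜ, f u v := fun u =>
    (Finset.sum_add_sum_compl X _).symm
  have h2 : ∀ u, ∑ v, f v u = ∑ v ∈ X, f v u + ∑ v ∈ Xᶜ, f v u := fun u =>
    (Finset.sum_add_sum_compl X _).symm
  simp only [netOut, h1, h2, Finset.sum_sub_distrib, Finset.sum_add_distrib]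
  rw [Finset.sum_comm (s := X) (t := X)]
  ring

omit [DecidableEq V] in
lemma IsFlow.netOut_eq_zero (hf : IsFlow c s t f) {v : V} (hs : v ≠ s) (ht : v ≠ t) :
    netOut f v = 0 := by
  rw [netOut, hf.conserve v hs ht, sub_self]

lemma IsFlow.value_eq (hf : IsFlow c s t f) {X : Finset V} (hs : s ∈ X) (ht : t ∉ X) :
    flowValue s f = ∑ u ∈ X, ∑ v ∈ Xᶜ, f u v - ∑ u ∈ X, ∑ v ∈ Xᶜ, f v u := by
  rw [← sum_netOut, Finset.sum_eq_single_of_mem s hs]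
  · rfl
  · intro v hv hvs
    exact hf.netOut_eq_zero hvs (fun h => ht (h ▸ hv))

/-- Some feasible direction at the flow `f` sends one unit from `s` to `v`. Feasible directions form
a convex cone, so, unlike augmenting paths, they can be concatenated without any care for repeated
edges. -/
def CanPush (c f : V → V → ℝ) (s v : V) : Prop :=
  ∃ h : V → V → ℝ, (∀ u w, f u w = 0 → 0 ≤ h u w) ∧ (∀ u w, f u w = c u w → h u w ≤ 0) ∧
    ∀ x, netOut h x = (if x = s then 1 else 0) - (if x = v then 1 else 0)

lemma CanPush.refl (c f : V → V → ℝ) (s : V) : CanPush c f s s :=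
  ⟨0, by simp, by simp, by simp [netOut]⟩

lemma netOut_add_single (h : V → V → ℝ) (a : ℝ) (u w x : V) :
    netOut (fun y z => h y z + if y = u ∧ z = w then a else 0) x =
      netOut h x + ((if x = u then a else 0) - (if x = w then a else 0)) := by
  simp only [netOut, Finset.sum_add_distrib]
  have h1 : ∑ z, (if x = u ∧ z = w then a else 0) = if x = u then a else 0 := by
    by_cases hx : x = u <;> simp [hx]
  have h2 : ∑ z, (if z = u ∧ x = w then a else 0) = if x = w then a else 0 := by
    by_cases hx : x = w <;> simp [hx]
  rw [h1, h2]
  ring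

lemma CanPush.forward {u w : V} (h : CanPush c f s u) (hlt : f u w < c u w) :
    CanPush c f s w := by
  obtain ⟨h, h0, h1, h2⟩ := h
  refine ⟨fun y z => h y z + if y = u ∧ z = w then 1 else 0, ?_, ?_, ?_⟩
  · intro y z hyz
    have := h0 y z hyz
    dsimp only
    split_ifs <;> linarith
  · intro y z hyz
    have := h1 y z hyz
    dsimp only
    split_ifs with hh
    · rw [hh.1, hh.2] at hyz
      exact absurd hyz hlt.ne
    · linarith
  · intro x
    rw [netOut_add_single, h2]
    ring

lemma CanPush.backward {u w : V} (h : CanPush c f s u) (hpos : 0 < f w u) :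
    CanPush c f s w := by
  obtain ⟨h, h0, h1, h2⟩ := h
  refine ⟨fun y z => h y z + if y = w ∧ z = u then -1 else 0, ?_, ?_, ?_⟩
  · intro y z hyz
    have := h0 y z hyz
    dsimp only
    split_ifs with hh
    · rw [hh.1, hh.2] at hyz
      exact absurd hyz hpos.ne'
    · linarith
  · intro y z hyz
    have := h1 y z hyz
    dsimp only
    split_ifs <;> linarith
  · intro x
    rw [netOut_add_single, h2]
    split_ifs <;> ring

lemma IsMaxFlow.not_canPush (hf : IsMaxFlow c s t f) (hst : s ≠ t) : ¬ CanPush c f s t := by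
  rintro ⟨h, h0, h1, h2⟩
  have key : ∀ u w, ∀ᶠ ε in nhdsWithin (0 : ℝ) (Set.Ioi 0),
      0 ≤ f u w + ε * h u w ∧ f u w + ε * h u w ≤ c u w := by
    intro u w
    have hlim : Filter.Tendsto (fun ε : ℝ => f u w + ε * h u w) (nhdsWithin 0 (Set.Ioi 0))
        (nhds (f u w)) := by
      have : Continuous fun ε : ℝ => f u w + ε * h u w := by fun_prop
      have h3 := this.tendsto 0
      simp only [zero_mul, add_zero] at h3
      exact h3.mono_left nhdsWithin_le_nhds
    refine Filter.Eventually.and ?_ ?_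
    · rcases (hf.1.nonneg u w).eq_or_lt with he | hlt
      · filter_upwards [self_mem_nhdsWithin] with ε hε
        rw [← he, zero_add]
        exact mul_nonneg (le_of_lt hε) (h0 u w he.symm)
      · exact (hlim.eventually (lt_mem_nhds hlt)).mono fun _ => le_of_lt
    · rcases (hf.1.le_cap u w).eq_or_lt with he | hlt
      · filter_upwards [self_mem_nhdsWithin] with ε hε
        have := mul_nonpos_of_nonneg_of_nonpos (le_of_lt hε) (h1 u w he)
        linarith
      · exact (hlim.eventually (gt_mem_nhds hlt)).mono fun _ => le_of_lt
  have key2 := Filter.eventually_all.2 fun u => Filter.eventually_all.2 fun w => key u w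
  obtain ⟨ε, hε, hpos⟩ := (key2.and self_mem_nhdsWithin).exists
  have hpos : 0 < ε := hpos
  have hnet : ∀ x, netOut (fun u w => f u w + ε * h u w) x = netOut f x + ε * netOut h x := by
    intro x
    simp only [netOut, Finset.sum_add_distrib, ← Finset.mul_sum]
    ring
  have hflow : IsFlow c s t fun u w => f u w + ε * h u w := by
    refine ⟨fun u w => (hε u w).1, fun u w => (hε u w).2, fun v hs ht => ?_⟩
    have := hnet v
    rw [hf.1.netOut_eq_zero hs ht, h2, if_neg hs, if_neg ht] at this
    rw [netOut] at this
    linarith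
  have h3 : netOut (fun u w => f u w + ε * h u w) s ≤ netOut f s := hf.2 _ hflow
  have h4 := hnet s
  rw [h2, if_pos rfl, if_neg hst] at h4
  rw [h4] at h3
  linarith

/-- A maximum flow saturates some cut: the set of vertices to which one can push more. -/
theorem IsMaxFlow.exists_cut (hf : IsMaxFlow c s t f) (hst : s ≠ t) :
    ∃ X : Finset V, s ∈ X ∧ t ∉ X ∧ flowValue s f = cutCap c X := by
  classical
  have hmem : ∀ v, v ∈ Finset.univ.filter (CanPush c f s) ↔ CanPush c f s v := by simp
  generalize Finset.univ.filter (CanPush c f s) = X at hmem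
  have hs : s ∈ X := (hmem s).2 (.refl c f s)
  have ht : t ∉ X := fun h => hf.not_canPush hst ((hmem t).1 h)
  refine ⟨X, hs, ht, ?_⟩
  rw [hf.1.value_eq hs ht, cutCap]
  have h1 : ∑ u ∈ X, ∑ v ∈ Xᶜ, f v u = 0 := by
    refine Finset.sum_eq_zero fun u hu => Finset.sum_eq_zero fun v hv => ?_
    rw [Finset.mem_compl, hmem] at hv
    by_contra hne
    exact hv (((hmem u).1 hu).backward (lt_of_le_of_ne (hf.1.nonneg v u) (Ne.symm hne)))
  rw [h1, sub_zero]
  refine Finset.sum_congr rfl fun u hu => Finset.sum_congr rfl fun v hv => ?_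
  rw [Finset.mem_compl, hmem] at hv
  by_contra hne
  exact hv (((hmem u).1 hu).forward (lt_of_le_of_ne (hf.1.le_cap u v) hne))

end Flow

/-! ### Layered networks -/

lemma Node.sum_eq {n L : ℕ} (g : Node n L → ℝ) :
    ∑ u, g u = g .src + ∑ i, g (.job i) + ∑ j, g (.itv j) + g .snk := by
  let e : (Unit ⊕ Fin n) ⊕ (Fin L ⊕ Unit) ≃ Node n L :=
    { toFun := Sum.elim (Sum.elim (fun _ => .src) .job) (Sum.elim .itv fun _ => .snk)
      invFun := fun u => match u with
        | .src => .inl (.inl ())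
        | .job i => .inl (.inr i)
        | .itv j => .inr (.inl j)
        | .snk => .inr (.inr ())
      left_inv := by rintro ((_ | _) | (_ | _)) <;> rfl
      right_inv := by rintro (_ | _ | _ | _) <;> rfl }
  rw [← Equiv.sum_comp e]
  simp [Fintype.sum_sum_type, e, add_assoc]

namespace Net

variable {n L : ℕ} {N : Net n L}

/-- `τ i j` is the flow from job `i` to interval `j` in a flow that saturates all the edges at the
source. -/
structure IsAssignment (N : Net n L) (τ : Fin n → Fin L → ℝ) : Prop where
  nonneg : ∀ i j, 0 ≤ τ i j
  le_link : ∀ i j, τ i j ≤ N.link i j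
  sum_eq : ∀ i, ∑ j, τ i j = N.supply i
  sum_le : ∀ j, ∑ i, τ i j ≤ N.drain j

/-- The most that the jobs in `A` can send to the sink when the other jobs send nothing. -/
def throughput (N : Net n L) (A : Finset (Fin n)) : ℝ := ∑ j, min (N.drain j) (∑ i ∈ A, N.link i j)

lemma IsAssignment.sum_supply_le {τ : Fin n → Fin L → ℝ} (h : N.IsAssignment τ)
    (A : Finset (Fin n)) : ∑ i ∈ A, N.supply i ≤ N.throughput A := by
  simp only [← h.sum_eq]
  rw [Finset.sum_comm, throughput]
  refine Finset.sum_le_sum fun j _ => le_min ?_ (Finset.sum_le_sum fun i _ => h.le_link i j)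
  exact (Finset.sum_le_sum_of_subset_of_nonneg (Finset.subset_univ A)
    fun i _ _ => h.nonneg i j).trans (h.sum_le j)

/-- The jobs on the source side of a cut. -/
def jobSide (X : Finset (Node n L)) : Finset (Fin n) := Finset.univ.filter fun i => Node.job i ∈ X

lemma cutCap_eq {X : Finset (Node n L)} (hs : Node.src ∈ X) (ht : Node.snk ∉ X) :
    cutCap N.cap X = ∑ i ∈ (jobSide X)ᶜ, N.supply i +
      ∑ j, if Node.itv j ∈ X then N.drain j else ∑ i ∈ jobSide X, N.link i j := by
  have h1 : cutCap N.cap X = ∑ u, ∑ v, if u ∈ X then (if v ∈ X then 0 else N.cap u v) else 0 := by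
    rw [cutCap, ← Finset.sum_filter_add_sum_filter_not (Finset.univ) (· ∈ X)]
    simp only [Finset.filter_mem_eq_inter, Finset.univ_inter]
    rw [Finset.sum_eq_zero (s := Finset.univ.filter (· ∉ X)), add_zero]
    · refine Finset.sum_congr rfl fun u hu => ?_
      simp only [hu, if_true]
      rw [Finset.sum_ite, Finset.sum_const_zero, zero_add]
      refine Finset.sum_congr ?_ fun _ _ => rfl
      ext; simp
    · intro u hu
      simp only [Finset.mem_filter] at hu
      simp [hu.2]
  rw [h1]
  simp only [Node.sum_eq, Net.cap, hs, ht, if_true, if_false]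
  have h2 : ∑ i, (if Node.job i ∈ X then 0 else N.supply i) = ∑ i ∈ (jobSide X)ᶜ, N.supply i := by
    rw [Finset.sum_ite, Finset.sum_const_zero, zero_add]
    refine Finset.sum_congr ?_ fun _ _ => rfl
    ext; simp [jobSide]
  have h3 : ∀ j, ∑ i ∈ jobSide X, N.link i j = ∑ i, if Node.job i ∈ X then N.link i j else 0 := by
    intro j
    rw [jobSide, Finset.sum_filter]
  rw [← h2]
  simp only [ite_self, Finset.sum_const_zero, add_zero, zero_add]
  have h4 : ∑ j, (if Node.itv j ∈ X then N.drain j else ∑ i ∈ jobSide X, N.link i j)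
      = ∑ j, (if Node.itv j ∈ X then 0 else ∑ i ∈ jobSide X, N.link i j)
        + ∑ j, (if Node.itv j ∈ X then N.drain j else 0) := by
    rw [← Finset.sum_add_distrib]
    refine Finset.sum_congr rfl fun j _ => ?_
    split_ifs <;> simp
  rw [h4, ← add_assoc]
  congr 2
  rw [Finset.sum_comm]
  refine Finset.sum_congr rfl fun j _ => ?_
  rw [h3]
  split_ifs <;> simp

/-- The least capacity of a cut with a given set of jobs on the source side. -/
def jobCut (N : Net n L) (A : Finset (Fin n)) : ℝ := ∑ i ∈ Aᶜ, N.supply i + N.throughput A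

lemma jobCut_le_cutCap {X : Finset (Node n L)} (hs : Node.src ∈ X) (ht : Node.snk ∉ X) :
    N.jobCut (jobSide X) ≤ cutCap N.cap X := by
  rw [cutCap_eq hs ht, jobCut, throughput]
  gcongr with j
  split_ifs
  · exact min_le_left _ _
  · exact min_le_right _ _

lemma exists_cutCap_eq_jobCut (A : Finset (Fin n)) :
    ∃ X : Finset (Node n L), Node.src ∈ X ∧ Node.snk ∉ X ∧ jobSide X = A ∧
      cutCap N.cap X = N.jobCut A := by
  classical
  let X : Finset (Node n L) := Finset.univ.filter fun u => match u with
    | .src => True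
    | .job i => i ∈ A
    | .itv j => N.drain j ≤ ∑ i ∈ A, N.link i j
    | .snk => False
  have hs : Node.src ∈ X := by simp [X]
  have ht : Node.snk ∉ X := by simp [X]
  have hA : jobSide X = A := by ext; simp [X, jobSide]
  refine ⟨X, hs, ht, hA, ?_⟩
  rw [cutCap_eq hs ht, hA, jobCut, throughput]
  congr 1
  refine Finset.sum_congr rfl fun j _ => ?_
  have : Node.itv j ∈ X ↔ N.drain j ≤ ∑ i ∈ A, N.link i j := by simp [X]
  rw [min_def]
  simp only [this]

/-- The job side of a minimum cut minimizes `jobCut`. -/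
lemma _root_.BAL.IsMinCut.jobCut_le {X : Finset (Node n L)} (hX : IsMinCut N.cap .src .snk X)
    (A : Finset (Fin n)) : N.jobCut (jobSide X) ≤ N.jobCut A := by
  obtain ⟨Y, hs, ht, -, hY⟩ := N.exists_cutCap_eq_jobCut A
  exact (jobCut_le_cutCap hX.1 hX.2.1).trans (hY ▸ hX.2.2 Y hs ht)

lemma exists_isMinCut (N : Net n L) : ∃ X, IsMinCut N.cap .src .snk X := by
  classical
  obtain ⟨X, hX, hmin⟩ := (Finset.univ.filter fun X : Finset (Node n L) =>
    Node.src ∈ X ∧ Node.snk ∉ X).exists_min_image (cutCap N.cap) ⟨{.src}, by simp⟩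
  simp only [Finset.mem_filter, Finset.mem_univ, true_and] at hX hmin
  exact ⟨X, hX.1, hX.2, fun Y h1 h2 => hmin Y ⟨h1, h2⟩⟩

variable {f : Node n L → Node n L → ℝ}

lemma _root_.BAL.IsFlow.apply_eq_zero {u v : Node n L} (hf : IsFlow N.cap .src .snk f)
    (h : N.cap u v = 0) : f u v = 0 :=
  le_antisymm (h ▸ hf.le_cap u v) (hf.nonneg u v)

lemma _root_.BAL.IsFlow.value_layered (hf : IsFlow N.cap .src .snk f) :
    flowValue .src f = ∑ i, f .src (.job i) := by
  rw [flowValue, Node.sum_eq, Node.sum_eq]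
  rw [hf.apply_eq_zero (u := .src) (v := .src) rfl, hf.apply_eq_zero (u := .src) (v := .snk) rfl,
    hf.apply_eq_zero (u := .snk) (v := .src) rfl]
  simp [fun i => hf.apply_eq_zero (u := .job i) (v := .src) rfl,
    fun i => hf.apply_eq_zero (u := .itv i) (v := .src) rfl,
    fun i => hf.apply_eq_zero (u := .src) (v := .itv i) rfl]

lemma _root_.BAL.IsFlow.sum_job (hf : IsFlow N.cap .src .snk f) (i : Fin n) :
    ∑ j, f (.job i) (.itv j) = f .src (.job i) := by
  have h := hf.conserve (.job i) (by simp) (by simp)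
  rw [Node.sum_eq, Node.sum_eq] at h
  simp only [fun i k => hf.apply_eq_zero (u := .job i) (v := .job k) rfl,
    fun k i => hf.apply_eq_zero (u := .itv k) (v := .job i) rfl,
    fun i => hf.apply_eq_zero (u := .job i) (v := .src) rfl,
    fun i => hf.apply_eq_zero (u := .job i) (v := .snk) rfl,
    fun i => hf.apply_eq_zero (u := .snk) (v := .job i) rfl, Finset.sum_const_zero, add_zero,
    zero_add] at h
  exact h.symm

lemma _root_.BAL.IsFlow.sum_itv (hf : IsFlow N.cap .src .snk f) (j : Fin L) :
    ∑ i, f (.job i) (.itv j) = f (.itv j) .snk := by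
  have h := hf.conserve (.itv j) (by simp) (by simp)
  rw [Node.sum_eq, Node.sum_eq] at h
  simp only [fun i k => hf.apply_eq_zero (u := .itv i) (v := .itv k) rfl,
    fun k i => hf.apply_eq_zero (u := .itv k) (v := .job i) rfl,
    fun i => hf.apply_eq_zero (u := .src) (v := .itv i) rfl,
    fun i => hf.apply_eq_zero (u := .itv i) (v := .src) rfl,
    fun i => hf.apply_eq_zero (u := .snk) (v := .itv i) rfl, Finset.sum_const_zero, add_zero,
    zero_add] at h
  exact h

/-- A flow that saturates the edges at the source yields an assignment. -/
lemma _root_.BAL.IsFlow.isAssignment (hf : IsFlow N.cap .src .snk f)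
    (hv : flowValue .src f = ∑ i, N.supply i) :
    N.IsAssignment fun i j => f (.job i) (.itv j) where
  nonneg i j := hf.nonneg _ _
  le_link i j := hf.le_cap (.job i) (.itv j)
  sum_eq i := by
    rw [hf.sum_job]
    rw [hf.value_layered] at hv
    exact (Finset.sum_eq_sum_iff_of_le fun i _ => hf.le_cap .src (.job i)).1 hv i
      (Finset.mem_univ i)
  sum_le j := by
    rw [hf.sum_itv]
    exact hf.le_cap (.itv j) .snk

/-- Hall's condition: if no set of jobs supplies more than its throughput, then every maximum flow
saturates the edges at the source. -/
lemma _root_.BAL.IsMaxFlow.value_eq_of_hall (hf : IsMaxFlow N.cap .src .snk f)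
    (h : ∀ A, ∑ i ∈ A, N.supply i ≤ N.throughput A) :
    flowValue .src f = ∑ i, N.supply i := by
  apply le_antisymm
  · rw [hf.1.value_layered]
    exact Finset.sum_le_sum fun i _ => hf.1.le_cap .src (.job i)
  · obtain ⟨X, hs, ht, hX⟩ := hf.exists_cut (by simp)
    rw [hX]
    refine le_trans ?_ (jobCut_le_cutCap hs ht)
    rw [jobCut, ← Finset.sum_add_sum_compl (jobSide X), add_comm]
    linarith [h (jobSide X)]

lemma _root_.BAL.IsMaxFlow.isAssignment_of_hall (hf : IsMaxFlow N.cap .src .snk f)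
    (h : ∀ A, ∑ i ∈ A, N.supply i ≤ N.throughput A) :
    N.IsAssignment fun i j => f (.job i) (.itv j) :=
  hf.1.isAssignment (hf.value_eq_of_hall h)

end Net

/-! ### The intervals between release dates and deadlines -/

namespace Jobs

variable {n : ℕ} (I : Jobs n)

lemma left_lt_right (j : Fin I.L) : I.left j < I.right j := by
  refine (I.times.orderEmbOfFin rfl).strictMono ?_
  simp [Fin.lt_def]

lemma len_pos (j : Fin I.L) : 0 < I.len j := sub_pos.2 (I.left_lt_right j)

lemma right_le_left {j k : Fin I.L} (h : j < k) : I.right j ≤ I.left k := by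
  refine (I.times.orderEmbOfFin rfl).monotone ?_
  simpa [Fin.le_def] using h

lemma L_le : I.L ≤ 2 * n := by
  have h1 := Finset.card_union_le (Finset.univ.image I.r) (Finset.univ.image I.d)
  have h2 := Finset.card_image_le (s := Finset.univ) (f := I.r)
  have h3 := Finset.card_image_le (s := Finset.univ) (f := I.d)
  rw [Finset.card_univ, Fintype.card_fin] at h2 h3
  change I.times.card - 1 ≤ _
  rw [times]
  omega

/-- The half-open version of the `j`-th interval. -/
def slot (j : Fin I.L) : Set ℝ := Set.Ico (I.left j) (I.right j)

lemma measurableSet_slot (j : Fin I.L) : MeasurableSet (I.slot j) := measurableSet_Ico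

lemma disjoint_slot {j k : Fin I.L} (h : j ≠ k) : Disjoint (I.slot j) (I.slot k) := by
  rw [Set.disjoint_left]
  rintro t ⟨h1, h2⟩ ⟨h3, h4⟩
  rcases lt_or_gt_of_ne h with h | h
  · exact absurd (I.right_le_left h) (by linarith)
  · exact absurd (I.right_le_left h) (by linarith)

lemma slot_eq {j k : Fin I.L} {t : ℝ} (hj : t ∈ I.slot j) (hk : t ∈ I.slot k) : j = k := by
  by_contra h
  exact Set.disjoint_left.1 (I.disjoint_slot h) hj hk

variable {I}

lemma Alive.slot_subset {i : Fin n} {j : Fin I.L} (h : I.Alive i j) :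
    I.slot j ⊆ Set.Ico (I.r i) (I.d i) := Set.Ico_subset_Ico h.1 h.2

lemma exists_eq_orderEmb {t : ℝ} (ht : t ∈ I.times) :
    ∃ k, I.times.orderEmbOfFin rfl k = t := by
  have := Finset.range_orderEmbOfFin I.times rfl
  have h2 : t ∈ Set.range (I.times.orderEmbOfFin rfl) := by rw [this]; exact ht
  exact h2

lemma exists_slot {i : Fin n} {t : ℝ} (ht : t ∈ Set.Ico (I.r i) (I.d i)) :
    ∃ j, I.Alive i j ∧ t ∈ I.slot j := by
  classical
  set e := I.times.orderEmbOfFin rfl with he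
  obtain ⟨a, ha⟩ := exists_eq_orderEmb (I := I) (t := I.r i) (by simp [times])
  obtain ⟨b, hb⟩ := exists_eq_orderEmb (I := I) (t := I.d i) (by simp [times])
  have hne : (Finset.univ.filter fun k => e k ≤ t).Nonempty := ⟨a, by simpa [he, ha] using ht.1⟩
  obtain ⟨k, hk, hmax⟩ := Finset.exists_max_image _ id hne
  simp only [Finset.mem_filter, Finset.mem_univ, true_and, id] at hk hmax
  have hkb : k < b := by
    rw [← e.lt_iff_lt]
    rw [hb]
    exact lt_of_le_of_lt hk ht.2
  have hkb' : (k : ℕ) + 1 ≤ b := hkb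
  have hb2 := b.2
  have hj : (k : ℕ) < I.L := by rw [L]; omega
  refine ⟨⟨k, hj⟩, ⟨?_, ?_⟩, ?_, ?_⟩
  · rw [← ha]
    exact e.monotone (hmax a (by rw [ha]; exact ht.1))
  · rw [← hb]
    exact e.monotone hkb'
  · exact hk
  · by_contra hlt
    have := hmax ⟨k + 1, by omega⟩ (not_lt.1 hlt)
    simp [Fin.le_def] at this

lemma alive_of_mem_slot {i : Fin n} {j : Fin I.L} {t : ℝ} (ht : t ∈ I.slot j)
    (h : t ∈ Set.Ico (I.r i) (I.d i)) : I.Alive i j := by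
  obtain ⟨k, hk, htk⟩ := exists_slot h
  rwa [I.slot_eq ht htk]

/-- A set of times within the span of a job is split by the intervals. -/
lemma volume_eq_sum (i : Fin n) {B : Set ℝ} (hB : MeasurableSet B)
    (hs : B ⊆ Set.Icc (I.r i) (I.d i)) :
    volume B = ∑ j, volume (B ∩ I.slot j) := by
  have h1 : B =ᵐ[volume] ⋃ j ∈ (Finset.univ : Finset (Fin I.L)), B ∩ I.slot j := by
    have h2 : ∀ᵐ t ∂(volume : Measure ℝ), t ≠ I.d i := by
      simp [ae_iff, measure_singleton]
    filter_upwards [h2] with t ht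
    simp only [Finset.mem_univ, Set.iUnion_true, eq_iff_iff, ← Set.inter_iUnion]
    change t ∈ B ↔ t ∈ B ∩ _
    refine ⟨fun h => ⟨h, ?_⟩, fun h => h.1⟩
    obtain ⟨j, -, hj⟩ := exists_slot (I := I) (i := i) ⟨(hs h).1, lt_of_le_of_ne (hs h).2 ht⟩
    exact Set.mem_iUnion.2 ⟨j, hj⟩
  rw [measure_congr h1, measure_biUnion_finset]
  · intro j _ k _ hjk
    exact (I.disjoint_slot hjk).mono Set.inter_subset_right Set.inter_subset_right
  · exact fun j _ => hB.inter (I.measurableSet_slot j)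

open Classical in
lemma sum_len (i : Fin n) : ∑ j, (if I.Alive i j then I.len j else 0) = I.d i - I.r i := by
  have h := volume_eq_sum (I := I) i measurableSet_Ico Set.Ico_subset_Icc_self
  have h2 : ∀ j, volume (Set.Ico (I.r i) (I.d i) ∩ I.slot j) =
      ENNReal.ofReal (if I.Alive i j then I.len j else 0) := by
    intro j
    split_ifs with hj
    · rw [Set.inter_eq_right.2 hj.slot_subset, slot, Real.volume_Ico, len]
    · rw [ENNReal.ofReal_zero, Set.disjoint_iff_inter_eq_empty.1, measure_empty]
      rw [Set.disjoint_left]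
      exact fun t ht htj => hj (alive_of_mem_slot htj ht)
  simp only [h2] at h
  rw [Real.volume_Ico, ← ENNReal.ofReal_sum_of_nonneg] at h
  · rw [ENNReal.ofReal_eq_ofReal_iff] at h
    · exact h.symm
    · exact (sub_pos.2 (I.r_lt_d i)).le
    · exact Finset.sum_nonneg fun j _ => by split_ifs <;> simp [(I.len_pos j).le]
  · exact fun j _ => by split_ifs <;> simp [(I.len_pos j).le]

lemma Alive.len_le {i : Fin n} {j : Fin I.L} (h : I.Alive i j) : I.len j ≤ I.d i - I.r i := by
  have := h.1; have := h.2; rw [len]; linarith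

end Jobs

/-! ### McNaughton's wrap-around rule -/

/-- Cutting the line into pieces of length `ℓ` preserves the total length of `[a, b)`. -/
lemma sum_volume_pieces {m : ℕ} {a b l ℓ : ℝ} (ha : 0 ≤ a) (hb : b ≤ m * ℓ) (hℓ : 0 < ℓ) :
    ∑ p : Fin m, volume {t | t ∈ Set.Ico l (l + ℓ) ∧ (p : ℕ) * ℓ + (t - l) ∈ Set.Ico a b} =
      ENNReal.ofReal (b - a) := by
  have h1 : ∀ p : ℕ, volume {t | t ∈ Set.Ico l (l + ℓ) ∧ p * ℓ + (t - l) ∈ Set.Ico a b} =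
      volume (Set.Ico a b ∩ Set.Ico (p * ℓ) ((p + 1 : ℕ) * ℓ)) := by
    intro p
    rw [← measure_preimage_add volume (p * ℓ - l) (Set.Ico a b ∩ _)]
    congr 1
    ext t
    simp only [Set.mem_ofPred_eq, Set.mem_preimage, Set.mem_inter_iff, Set.mem_Ico]
    push_cast
    constructor
    · rintro ⟨⟨h1, h2⟩, h3, h4⟩
      refine ⟨⟨?_, ?_⟩, ?_, ?_⟩ <;> linarith
    · rintro ⟨⟨h1, h2⟩, h3, h4⟩
      refine ⟨⟨?_, ?_⟩, ?_, ?_⟩ <;> linarith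
  have h2 : ∀ k : ℕ, ∑ p ∈ Finset.range k, volume (Set.Ico a b ∩ Set.Ico (p * ℓ) ((p + 1 : ℕ) * ℓ))
      = volume (Set.Ico a b ∩ Set.Ico 0 (k * ℓ)) := by
    intro k
    induction k with
    | zero => simp
    | succ k ih =>
      rw [Finset.sum_range_succ, ih, ← measure_union]
      · rw [← Set.inter_union_distrib_left, Set.Ico_union_Ico_eq_Ico (by positivity)]
        push_cast
        linarith
      · refine Disjoint.mono Set.inter_subset_right Set.inter_subset_right ?_
        simp [Set.disjoint_left]
        intros
        linarith
      · exact measurableSet_Ico.inter measurableSet_Ico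
  simp only [h1]
  rw [Fin.sum_univ_eq_sum_range
    (fun p : ℕ => volume (Set.Ico a b ∩ Set.Ico (p * ℓ) ((p + 1 : ℕ) * ℓ))), h2,
    Set.inter_eq_left.2 (Set.Ico_subset_Ico ha hb), Real.volume_Ico]

section WrapAround

variable {n m : ℕ} {I : Jobs n}

open Classical in
/-- Execution times that fit into the intervals when `mach j` processors are available during the
`j`-th interval. -/
structure Fits (I : Jobs n) (mach : Fin I.L → ℕ) (τ : Fin n → Fin I.L → ℝ) : Prop where
  nonneg : ∀ i j, 0 ≤ τ i j
  le_len : ∀ i j, τ i j ≤ if I.Alive i j then I.len j else 0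
  sum_le : ∀ j, ∑ i, τ i j ≤ mach j * I.len j

variable {mach : Fin I.L → ℕ} {τ : Fin n → Fin I.L → ℝ}

lemma Fits.alive (h : Fits I mach τ) {i : Fin n} {j : Fin I.L} (hτ : 0 < τ i j) : I.Alive i j := by
  by_contra hn
  have := h.le_len i j
  rw [if_neg hn] at this
  linarith

lemma Fits.le_len' (h : Fits I mach τ) (i : Fin n) (j : Fin I.L) : τ i j ≤ I.len j := by
  refine (h.le_len i j).trans ?_
  split_ifs
  · exact le_rfl
  · exact (I.len_pos j).le

/-- The piece of the line that belongs to job `i` in the `j`-th interval. -/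
def piece (τ : Fin n → Fin I.L → ℝ) (i : Fin n) (j : Fin I.L) : Set ℝ :=
  Set.Ico (∑ k ∈ Finset.Iio i, τ k j) (∑ k ∈ Finset.Iic i, τ k j)

lemma sum_Iic (τ : Fin n → Fin I.L → ℝ) (i : Fin n) (j : Fin I.L) :
    ∑ k ∈ Finset.Iic i, τ k j = ∑ k ∈ Finset.Iio i, τ k j + τ i j := by
  rw [← Finset.Iio_insert, Finset.sum_insert (by simp), add_comm]

lemma Fits.piece_unique (h : Fits I mach τ) {i i' : Fin n} {j : Fin I.L} {y : ℝ}
    (hi : y ∈ piece τ i j) (hi' : y ∈ piece τ i' j) : i = i' := by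
  have key : ∀ {a b : Fin n}, a < b → y ∈ piece τ a j → y ∈ piece τ b j → False := by
    intro a b hab ha hb
    have : ∑ k ∈ Finset.Iic a, τ k j ≤ ∑ k ∈ Finset.Iio b, τ k j :=
      Finset.sum_le_sum_of_subset_of_nonneg
        (fun x hx => Finset.mem_Iio.2 (lt_of_le_of_lt (Finset.mem_Iic.1 hx) hab))
        fun i _ _ => h.nonneg i j
    exact absurd (this.trans hb.1) (not_le.2 ha.2)
  rcases lt_trichotomy i i' with hlt | heq | hlt
  · exact (key hlt hi hi').elim
  · exact heq
  · exact (key hlt hi' hi).elim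

lemma Fits.wrapAround_job (h : Fits I mach τ) (s : Fin n → ℝ) {p : Fin m} {t : ℝ} {i : Fin n} :
    (wrapAround I m τ s).job p t = some i ↔
      ∃ j, t ∈ I.slot j ∧ (p : ℕ) * I.len j + (t - I.left j) ∈ piece τ i j := by
  simp only [wrapAround]
  constructor
  · intro hi
    split_ifs at hi with hex
    obtain rfl := Option.some.inj hi
    exact hex.choose_spec
  · rintro ⟨j, hj, hp⟩
    rw [dif_pos ⟨i, j, hj, hp⟩]
    generalize_proofs hex
    obtain ⟨j', hj', hp'⟩ := hex.choose_spec
    obtain rfl := I.slot_eq hj hj'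
    rw [h.piece_unique hp' hp]

lemma wrapAround_speed (s : Fin n → ℝ) {p : Fin m} {t : ℝ} {i : Fin n}
    (hi : (wrapAround I m τ s).job p t = some i) : (wrapAround I m τ s).speed p t = s i := by
  change (match (wrapAround I m τ s).job p t with
    | some i => s i
    | none => 0) = s i
  rw [hi]

lemma wrapAround_speed_none (s : Fin n → ℝ) {p : Fin m} {t : ℝ}
    (hi : (wrapAround I m τ s).job p t = none) : (wrapAround I m τ s).speed p t = 0 := by
  change (match (wrapAround I m τ s).job p t with
    | some i => s i
    | none => 0) = 0
  rw [hi]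

/-- A function of the speed that vanishes at `0` is a combination of indicators. -/
lemma wrapAround_comp_speed {β : Type*} [AddCommMonoid β] (s : Fin n → ℝ) (g : ℝ → β)
    (hg : g 0 = 0) (p : Fin m) (t : ℝ) :
    g ((wrapAround I m τ s).speed p t) =
      ∑ i, ((wrapAround I m τ s).runs p i).indicator (fun _ => g (s i)) t := by
  rcases hj : (wrapAround I m τ s).job p t with _ | i
  · rw [wrapAround_speed_none s hj, hg, Finset.sum_eq_zero]
    intro i _
    exact Set.indicator_of_notMem (by simp [Schedule.runs, hj]) _
  · rw [wrapAround_speed s hj, Finset.sum_eq_single_of_mem i (Finset.mem_univ i)]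
    · rw [Set.indicator_of_mem]
      exact hj
    · intro k _ hk
      exact Set.indicator_of_notMem (by simp [Schedule.runs, hj, hk.symm]) _

lemma Fits.wrapAround_runs (h : Fits I mach τ) (s : Fin n → ℝ) (p : Fin m) (i : Fin n) :
    (wrapAround I m τ s).runs p i = ⋃ j ∈ (Finset.univ : Finset (Fin I.L)),
      {t | t ∈ Set.Ico (I.left j) (I.left j + I.len j) ∧
        (p : ℕ) * I.len j + (t - I.left j) ∈ piece τ i j} := by
  ext t
  simp only [Schedule.runs, Set.mem_ofPred_eq, h.wrapAround_job, Jobs.slot, Jobs.len]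
  simp

lemma measurableSet_wrap (a l c : ℝ) (τ : Fin n → Fin I.L → ℝ) (i : Fin n) (j : Fin I.L) :
    MeasurableSet {t | t ∈ Set.Ico a l ∧ c + (t - a) ∈ piece τ i j} := by
  refine measurableSet_Ico.inter ?_
  have : Measurable fun t : ℝ => c + (t - a) := by fun_prop
  exact this measurableSet_Ico

lemma Fits.measurableSet_runs (h : Fits I mach τ) (s : Fin n → ℝ) (p : Fin m) (i : Fin n) :
    MeasurableSet ((wrapAround I m τ s).runs p i) := by
  rw [h.wrapAround_runs]
  exact Finset.measurableSet_biUnion _ fun j _ => measurableSet_wrap _ _ _ _ _ _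

lemma Fits.volume_runs_slot (h : Fits I mach τ) (hm : ∀ j, mach j ≤ m) (s : Fin n → ℝ) (i : Fin n)
    (j : Fin I.L) :
    ∑ p : Fin m, volume ((wrapAround I m τ s).runs p i ∩ I.slot j) = ENNReal.ofReal (τ i j) := by
  have h1 : ∀ p : Fin m, (wrapAround I m τ s).runs p i ∩ I.slot j =
      {t | t ∈ Set.Ico (I.left j) (I.left j + I.len j) ∧
        (p : ℕ) * I.len j + (t - I.left j) ∈ piece τ i j} := by
    intro p
    have h2 : I.slot j = Set.Ico (I.left j) (I.left j + I.len j) := by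
      rw [Jobs.slot, Jobs.len, add_sub_cancel]
    ext t
    rw [← h2]
    simp only [Schedule.runs, Set.mem_inter_iff, Set.mem_ofPred_eq, h.wrapAround_job]
    constructor
    · rintro ⟨⟨k, hk, hp⟩, hj⟩
      obtain rfl := I.slot_eq hj hk
      exact ⟨hj, hp⟩
    · rintro ⟨hj, hp⟩
      exact ⟨⟨j, hj, hp⟩, hj⟩
  simp only [h1]
  rw [piece, sum_volume_pieces (Finset.sum_nonneg fun k _ => h.nonneg k j) ?_ (I.len_pos j),
    sum_Iic, add_sub_cancel_left]
  refine le_trans (Finset.sum_le_sum_of_subset_of_nonneg (Finset.subset_univ _)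
    fun k _ _ => h.nonneg k j) ((h.sum_le j).trans ?_)
  exact mul_le_mul_of_nonneg_right (by exact_mod_cast hm j) (I.len_pos j).le

lemma Fits.alive_of_job (h : Fits I mach τ) (s : Fin n → ℝ) {p : Fin m} {t : ℝ} {i : Fin n}
    (hi : (wrapAround I m τ s).job p t = some i) :
    ∃ j, t ∈ I.slot j ∧ 0 < τ i j ∧ (p : ℕ) < mach j := by
  obtain ⟨j, hj, hp⟩ := (h.wrapAround_job s).1 hi
  refine ⟨j, hj, ?_, ?_⟩
  · have := hp.1.trans_lt hp.2
    rw [sum_Iic] at this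
    linarith
  · have h1 : (p : ℕ) * I.len j + (t - I.left j) < mach j * I.len j := by
      refine hp.2.trans_le (le_trans ?_ (h.sum_le j))
      exact Finset.sum_le_sum_of_subset_of_nonneg (Finset.subset_univ _) fun k _ _ => h.nonneg k j
    have h2 : ((p : ℕ) : ℝ) * I.len j < mach j * I.len j := by linarith [hj.1]
    exact_mod_cast lt_of_mul_lt_mul_right h2 (I.len_pos j).le

theorem Fits.wrapAround_valid (h : Fits I mach τ) {s : Fin n → ℝ} (hs : ∀ i, 0 ≤ s i) :
    (wrapAround I m τ s).Valid I where
  measurable_runs := h.measurableSet_runs s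
  measurable_speed p := by
    have : (wrapAround I m τ s).speed p =
        fun t => ∑ i, ((wrapAround I m τ s).runs p i).indicator (fun _ => s i) t :=
      funext fun t => wrapAround_comp_speed s id rfl p t
    rw [this]
    exact Finset.measurable_sum _ fun i _ => measurable_const.indicator (h.measurableSet_runs s p i)
  speed_nonneg p t := by
    rcases hj : (wrapAround I m τ s).job p t with _ | i
    · rw [wrapAround_speed_none s hj]
    · rw [wrapAround_speed s hj]
      exact hs i
  no_parallel p q t i hp hq := by
    obtain ⟨j, hj, hp⟩ := (h.wrapAround_job s).1 hp
    obtain ⟨j', hj', hq⟩ := (h.wrapAround_job s).1 hq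
    obtain rfl := I.slot_eq hj hj'
    rw [piece, sum_Iic] at hp hq
    have hle := h.le_len' i j
    have key : ∀ {a b : Fin m}, a < b →
        ((a : ℕ) : ℝ) * I.len j + I.len j ≤ ((b : ℕ) : ℝ) * I.len j := by
      intro a b hab
      have : ((a : ℕ) : ℝ) + 1 ≤ ((b : ℕ) : ℝ) := by exact_mod_cast hab
      nlinarith [I.len_pos j]
    rcases lt_trichotomy p q with hlt | heq | hlt
    · have := key hlt
      linarith [hp.1, hq.2]
    · exact heq
    · have := key hlt
      linarith [hq.1, hp.2]
  in_span p t i hi := by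
    obtain ⟨j, hj, hτ, -⟩ := h.alive_of_job s hi
    exact Set.Ico_subset_Icc_self ((h.alive hτ).slot_subset hj)

lemma Fits.sum_volume_runs (h : Fits I mach τ) (hm : ∀ j, mach j ≤ m) {s : Fin n → ℝ}
    (hs : ∀ i, 0 ≤ s i) (i : Fin n) :
    ∑ p : Fin m, volume ((wrapAround I m τ s).runs p i) = ENNReal.ofReal (∑ j, τ i j) := by
  have hv := h.wrapAround_valid (m := m) hs
  simp only [fun p => Jobs.volume_eq_sum (I := I) i (hv.measurable_runs p i)
    fun t ht => hv.in_span p t i ht]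
  rw [Finset.sum_comm, ENNReal.ofReal_sum_of_nonneg fun j _ => h.nonneg i j]
  exact Finset.sum_congr rfl fun j _ => h.volume_runs_slot hm s i j

theorem Fits.wrapAround_workDone (h : Fits I mach τ) (hm : ∀ j, mach j ≤ m) {s : Fin n → ℝ}
    (hs : ∀ i, 0 ≤ s i) (i : Fin n) :
    (wrapAround I m τ s).workDone i = ENNReal.ofReal (s i * ∑ j, τ i j) := by
  rw [ENNReal.ofReal_mul (hs i), ← h.sum_volume_runs hm hs, Finset.mul_sum, Schedule.workDone]
  refine Finset.sum_congr rfl fun p _ => ?_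
  rw [← setLIntegral_const]
  refine setLIntegral_congr_fun (h.measurableSet_runs s p i) fun t ht => ?_
  rw [wrapAround_speed s ht]

theorem Fits.wrapAround_energy (h : Fits I mach τ) (hm : ∀ j, mach j ≤ m) {s : Fin n → ℝ}
    (hs : ∀ i, 0 ≤ s i) {α : ℝ} (hα : α ≠ 0) :
    (wrapAround I m τ s).energy α = ENNReal.ofReal (∑ i, s i ^ α * ∑ j, τ i j) := by
  rw [ENNReal.ofReal_sum_of_nonneg fun i _ => mul_nonneg (Real.rpow_nonneg (hs i) α)
    (Finset.sum_nonneg fun j _ => h.nonneg i j), Schedule.energy]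
  have h1 : ∀ p : Fin m, ∫⁻ t, ENNReal.ofReal ((wrapAround I m τ s).speed p t ^ α) =
      ∑ i, ENNReal.ofReal (s i ^ α) * volume ((wrapAround I m τ s).runs p i) := by
    intro p
    simp only [fun t => wrapAround_comp_speed (I := I) (τ := τ) s
      (fun x => ENNReal.ofReal (x ^ α)) (by simp [Real.zero_rpow hα]) p t]
    rw [lintegral_finsetSum _ fun i _ => measurable_const.indicator (h.measurableSet_runs s p i)]
    refine Finset.sum_congr rfl fun i _ => ?_
    rw [lintegral_indicator_const (h.measurableSet_runs s p i)]
  simp only [h1]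
  rw [Finset.sum_comm]
  refine Finset.sum_congr rfl fun i _ => ?_
  rw [ENNReal.ofReal_mul (Real.rpow_nonneg (hs i) α), ← h.sum_volume_runs hm hs, Finset.mul_sum]

end WrapAround

/-! ### Execution times of a schedule -/

section ProcTime

variable {n m : ℕ} {I : Jobs n} {σ : Schedule n m} {mach : Fin I.L → ℕ}

namespace Schedule

/-- The execution time of job `i` in the `j`-th interval. -/
def itvTime (I : Jobs n) (σ : Schedule n m) (i : Fin n) (j : Fin I.L) : ℝ :=
  σ.procTime i (Set.Icc (I.left j) (I.right j))

lemma volume_inter_slot (B : Set ℝ) (j : Fin I.L) :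
    volume (B ∩ Set.Icc (I.left j) (I.right j)) = volume (B ∩ I.slot j) :=
  measure_congr (Filter.EventuallyEq.rfl.inter Ico_ae_eq_Icc.symm)

lemma volume_inter_slot_le (B : Set ℝ) (j : Fin I.L) :
    volume (B ∩ I.slot j) ≤ ENNReal.ofReal (I.len j) := by
  refine (measure_mono Set.inter_subset_right).trans ?_
  rw [Jobs.slot, Real.volume_Ico, Jobs.len]

lemma volume_inter_slot_ne_top (B : Set ℝ) (j : Fin I.L) : volume (B ∩ I.slot j) ≠ ⊤ :=
  ne_top_of_le_ne_top ENNReal.ofReal_ne_top (volume_inter_slot_le B j)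

lemma ofReal_itvTime (i : Fin n) (j : Fin I.L) :
    ENNReal.ofReal (σ.itvTime I i j) = ∑ p, volume (σ.runs p i ∩ I.slot j) := by
  rw [itvTime, procTime, ENNReal.ofReal_sum_of_nonneg fun _ _ => ENNReal.toReal_nonneg]
  refine Finset.sum_congr rfl fun p _ => ?_
  rw [volume_inter_slot, ENNReal.ofReal_toReal (volume_inter_slot_ne_top _ j)]

lemma itvTime_nonneg (i : Fin n) (j : Fin I.L) : 0 ≤ σ.itvTime I i j := by
  rw [itvTime, procTime]
  exact Finset.sum_nonneg fun _ _ => ENNReal.toReal_nonneg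

lemma Valid.sum_volume_runs (h : σ.Valid I) (i : Fin n) :
    ∑ p, volume (σ.runs p i) = ENNReal.ofReal (∑ j, σ.itvTime I i j) := by
  rw [ENNReal.ofReal_sum_of_nonneg fun j _ => itvTime_nonneg i j]
  simp only [ofReal_itvTime]
  rw [Finset.sum_comm]
  exact Finset.sum_congr rfl fun p _ =>
    Jobs.volume_eq_sum i (h.measurable_runs p i) fun t ht => h.in_span p t i ht

theorem Valid.fits (h : σ.Valid I)
    (ha : ∀ j p t i, t ∈ Set.Ioo (I.left j) (I.right j) → σ.job p t = some i → (p : ℕ) < mach j) :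
    Fits I mach (σ.itvTime I) where
  nonneg := itvTime_nonneg
  le_len i j := by
    rw [← ENNReal.ofReal_le_ofReal_iff (by split_ifs <;> simp [(I.len_pos j).le]), ofReal_itvTime]
    split_ifs with hj
    · rw [← measure_biUnion_finset]
      · refine (measure_mono (Set.iUnion₂_subset fun p _ => Set.inter_subset_right)).trans ?_
        rw [Jobs.slot, Real.volume_Ico, Jobs.len]
      · intro p _ q _ hpq
        rw [Function.onFun, Set.disjoint_left]
        rintro t ⟨h1, -⟩ ⟨h2, -⟩
        exact hpq (h.no_parallel p q t i h1 h2)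
      · exact fun p _ => (h.measurable_runs p i).inter (I.measurableSet_slot j)
    · -- Outside its life span, the job can only be executed at its deadline.
      rw [ENNReal.ofReal_zero, nonpos_iff_eq_zero]
      refine Finset.sum_eq_zero fun p _ => measure_mono_null ?_ (measure_singleton (I.d i))
      rintro t ⟨h1, h2⟩
      have h3 := h.in_span p t i h1
      by_contra hne
      exact hj (Jobs.alive_of_mem_slot h2 ⟨h3.1, lt_of_le_of_ne h3.2 hne⟩)
  sum_le j := by
    rw [← ENNReal.ofReal_le_ofReal_iff (mul_nonneg (Nat.cast_nonneg _) (I.len_pos j).le),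
      ENNReal.ofReal_sum_of_nonneg fun i _ => itvTime_nonneg i j]
    simp only [ofReal_itvTime]
    rw [Finset.sum_comm]
    have h1 : ∀ p : Fin m, ∑ i, volume (σ.runs p i ∩ I.slot j) ≤
        if (p : ℕ) < mach j then ENNReal.ofReal (I.len j) else 0 := by
      intro p
      rw [← measure_biUnion_finset]
      · split_ifs with hp
        · refine (measure_mono (Set.iUnion₂_subset fun i _ => Set.inter_subset_right)).trans ?_
          rw [Jobs.slot, Real.volume_Ico, Jobs.len]
        · rw [nonpos_iff_eq_zero]
          refine measure_mono_null ?_ (measure_singleton (I.left j))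
          intro t ht
          simp only [Set.mem_iUnion] at ht
          obtain ⟨i, -, h1, h2⟩ := ht
          by_contra hne
          exact hp (ha j p t i ⟨lt_of_le_of_ne h2.1 (Ne.symm hne), h2.2⟩ h1)
      · intro i _ k _ hik
        rw [Function.onFun, Set.disjoint_left]
        rintro t ⟨h1, -⟩ ⟨h2, -⟩
        exact hik (Option.some.inj (h1.symm.trans h2))
      · exact fun i _ => (h.measurable_runs p i).inter (I.measurableSet_slot j)
    refine (Finset.sum_le_sum fun p _ => h1 p).trans ?_
    rw [← Finset.sum_filter, Finset.sum_const, nsmul_eq_mul, ENNReal.ofReal_mul (by positivity),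
      ENNReal.ofReal_natCast]
    gcongr
    rw [← Finset.card_range (mach j)]
    exact Finset.card_le_card_of_injOn Fin.val (fun p hp => by simpa using hp)
      Fin.val_injective.injOn

lemma Valid.fits_const (h : σ.Valid I) : Fits I (fun _ => m) (σ.itvTime I) :=
  h.fits fun _ p _ _ _ _ => p.2

lemma workDone_of_speed {v : ℝ} (h : σ.Valid I) (hv : 0 ≤ v) (i : Fin n)
    (hs : ∀ p t, σ.job p t = some i → σ.speed p t = v) :
    σ.workDone i = ENNReal.ofReal (v * ∑ j, σ.itvTime I i j) := by
  rw [ENNReal.ofReal_mul hv, ← h.sum_volume_runs, Finset.mul_sum, workDone]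
  refine Finset.sum_congr rfl fun p _ => ?_
  rw [← setLIntegral_const]
  refine setLIntegral_congr_fun (h.measurable_runs p i) fun t ht => ?_
  rw [hs p t ht]

end Schedule

lemma Fits.itvTime_wrapAround {τ : Fin n → Fin I.L → ℝ} (h : Fits I mach τ)
    (hm : ∀ j, mach j ≤ m) (s : Fin n → ℝ) (i : Fin n) (j : Fin I.L) :
    (wrapAround I m τ s).itvTime I i j = τ i j := by
  rw [← ENNReal.ofReal_eq_ofReal_iff (Schedule.itvTime_nonneg i j) (h.nonneg i j),
    Schedule.ofReal_itvTime, h.volume_runs_slot hm]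

end ProcTime

/-! ### The rank function -/

section Rank

variable {n m : ℕ} {I : Jobs n} {mach : Fin I.L → ℕ}

/-- The largest total execution time of the jobs in `A` when `mach j` processors are available in
the `j`-th interval. It is the rank function of a polymatroid. -/
def rank (I : Jobs n) (mach : Fin I.L → ℕ) (A : Finset (Fin n)) : ℝ :=
  ∑ j, I.len j * (min (mach j) (A ∩ I.aliveSet j).card : ℕ)

lemma mem_aliveSet {i : Fin n} {j : Fin I.L} : i ∈ I.aliveSet j ↔ I.Alive i j := by
  simp [Jobs.aliveSet]

@[simp] lemma rank_empty : rank I mach ∅ = 0 := by simp [rank]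

lemma rank_mono {A B : Finset (Fin n)} (h : A ⊆ B) : rank I mach A ≤ rank I mach B := by
  refine Finset.sum_le_sum fun j _ => mul_le_mul_of_nonneg_left ?_ (I.len_pos j).le
  have := Finset.card_le_card (Finset.inter_subset_inter_right (u := I.aliveSet j) h)
  exact_mod_cast min_le_min le_rfl this

lemma rank_submodular (A B : Finset (Fin n)) :
    rank I mach (A ∪ B) + rank I mach (A ∩ B) ≤ rank I mach A + rank I mach B := by
  simp only [rank, ← Finset.sum_add_distrib, ← mul_add]
  refine Finset.sum_le_sum fun j _ => mul_le_mul_of_nonneg_left ?_ (I.len_pos j).le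
  have h1 := Finset.card_union_add_card_inter (A ∩ I.aliveSet j) (B ∩ I.aliveSet j)
  have h2 := Finset.card_le_card (Finset.inter_subset_left
    (s₁ := A ∩ I.aliveSet j) (s₂ := B ∩ I.aliveSet j))
  have h3 := Finset.card_le_card (Finset.inter_subset_right
    (s₁ := A ∩ I.aliveSet j) (s₂ := B ∩ I.aliveSet j))
  rw [← Finset.union_inter_distrib_right, ← Finset.inter_inter_distrib_right] at h1
  rw [← Finset.inter_inter_distrib_right] at h2 h3
  norm_cast
  omega

/-- The processors left over by the jobs in `C` give the contraction of the polymatroid by `C`. -/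
lemma rank_contract {mach' : Fin I.L → ℕ} {C B : Finset (Fin n)} (h : Disjoint C B)
    (h' : ∀ j, mach' j = mach j - (C ∩ I.aliveSet j).card) :
    rank I mach' B = rank I mach (C ∪ B) - rank I mach C := by
  rw [eq_sub_iff_add_eq]
  simp only [rank, ← Finset.sum_add_distrib, ← mul_add]
  refine Finset.sum_congr rfl fun j _ => ?_
  congr 1
  have h1 : ((C ∪ B) ∩ I.aliveSet j).card =
      (C ∩ I.aliveSet j).card + (B ∩ I.aliveSet j).card := by
    rw [Finset.union_inter_distrib_right, Finset.card_union_of_disjoint]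
    exact h.mono Finset.inter_subset_left Finset.inter_subset_left
  rw [h1, h']
  norm_cast
  omega

open Classical in
lemma sum_link (A : Finset (Fin n)) (j : Fin I.L) :
    ∑ i ∈ A, (if I.Alive i j then I.len j else 0) = I.len j * (A ∩ I.aliveSet j).card := by
  rw [← Finset.sum_filter, Finset.sum_const, nsmul_eq_mul, mul_comm, Jobs.aliveSet,
    Finset.inter_filter, Finset.inter_univ]

open Classical in
lemma min_drain_link (A : Finset (Fin n)) (j : Fin I.L) :
    min (mach j * I.len j) (∑ i ∈ A, (if I.Alive i j then I.len j else 0)) =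
      I.len j * (min (mach j) (A ∩ I.aliveSet j).card : ℕ) := by
  rw [sum_link, mul_comm, Nat.cast_min, mul_min_of_nonneg _ _ (I.len_pos j).le]

lemma Fits.sum_le_rank_term {τ : Fin n → Fin I.L → ℝ} (h : Fits I mach τ) (A : Finset (Fin n))
    (j : Fin I.L) :
    ∑ i ∈ A, τ i j ≤ I.len j * (min (mach j) (A ∩ I.aliveSet j).card : ℕ) := by
  classical
  rw [← min_drain_link]
  refine le_min ?_ (Finset.sum_le_sum fun i _ => ?_)
  · exact (Finset.sum_le_sum_of_subset_of_nonneg (Finset.subset_univ A)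
      fun i _ _ => h.nonneg i j).trans (h.sum_le j)
  · convert h.le_len i j

lemma Fits.sum_le_rank {τ : Fin n → Fin I.L → ℝ} (h : Fits I mach τ) (A : Finset (Fin n)) :
    ∑ i ∈ A, ∑ j, τ i j ≤ rank I mach A := by
  rw [Finset.sum_comm]
  exact Finset.sum_le_sum fun j _ => h.sum_le_rank_term A j

lemma rank_le_span (i : Fin n) : rank I mach {i} ≤ I.d i - I.r i := by
  classical
  rw [← I.sum_len i]
  refine Finset.sum_le_sum fun j _ => ?_
  have := sum_link (I := I) {i} j
  rw [Finset.sum_singleton] at this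
  rw [this]
  exact mul_le_mul_of_nonneg_left (by exact_mod_cast min_le_right _ _) (I.len_pos j).le

end Rank

/-! ### Feasibility of the work assignment problem -/

namespace State

variable {n m : ℕ} {I : Jobs n} {S : State I} {v : ℝ}

/-- Hall's condition for the work assignment problem with speed `v`: no set of remaining jobs has
more work than can be done at speed `v`. -/
def Loaded (S : State I) (v : ℝ) : Prop := ∀ A ⊆ S.jobs, ∑ i ∈ A, I.w i ≤ v * rank I S.mach A

lemma net_nonneg (S : State I) (hv : 0 ≤ v) : (S.net v).Nonneg := by
  refine ⟨fun i => ?_, fun i j => ?_, fun j => mul_nonneg (Nat.cast_nonneg _) (I.len_pos j).le⟩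
  · simp only [net]
    split_ifs
    · exact div_nonneg (I.w_pos i).le hv
    · exact le_rfl
  · simp only [net]
    split_ifs
    · exact (I.len_pos j).le
    · exact le_rfl

lemma throughput_net (A : Finset (Fin n)) :
    (S.net v).throughput A = rank I S.mach (A ∩ S.jobs) := by
  classical
  rw [Net.throughput, rank]
  refine Finset.sum_congr rfl fun j _ => ?_
  rw [← min_drain_link, ← Finset.filter_mem_eq_inter, Finset.sum_filter]
  simp only [net]
  congr 1
  refine Finset.sum_congr rfl fun i _ => ?_
  by_cases h : i ∈ S.jobs <;> simp [h]

lemma sum_supply_net (A : Finset (Fin n)) :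
    ∑ i ∈ A, (S.net v).supply i = (∑ i ∈ A ∩ S.jobs, I.w i) / v := by
  rw [← Finset.filter_mem_eq_inter, Finset.sum_filter, Finset.sum_div]
  refine Finset.sum_congr rfl fun i _ => ?_
  simp only [net]
  split_ifs <;> simp

lemma hall_iff_loaded (hv : 0 < v) :
    (∀ A, ∑ i ∈ A, (S.net v).supply i ≤ (S.net v).throughput A) ↔ S.Loaded v := by
  simp only [sum_supply_net, throughput_net, div_le_iff₀ hv]
  constructor
  · intro h A hA
    have := h A
    rw [Finset.inter_eq_left.2 hA] at this
    linarith
  · intro h A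
    have := h _ (Finset.inter_subset_right (s₁ := A))
    linarith

lemma _root_.BAL.Net.IsAssignment.fits {τ : Fin n → Fin I.L → ℝ}
    (h : (S.net v).IsAssignment τ) : Fits I S.mach τ where
  nonneg := h.nonneg
  le_len i j := by
    refine (h.le_link i j).trans ?_
    simp only [net]
    have := (I.len_pos j).le
    by_cases h1 : i ∈ S.jobs <;> by_cases h2 : I.Alive i j <;> simp [h1, h2, this]
  sum_le := h.sum_le

lemma WapSchedule.fits {σ : Schedule n m} (h : S.WapSchedule v σ) : Fits I S.mach (σ.itvTime I) :=
  h.valid.fits h.avail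

lemma WapSchedule.sum_itvTime {σ : Schedule n m} (h : S.WapSchedule v σ) (hv : 0 < v) {i : Fin n}
    (hi : i ∈ S.jobs) : ∑ j, σ.itvTime I i j = I.w i / v := by
  have h1 := Schedule.workDone_of_speed h.valid hv.le i fun p t => h.speed_eq p t i
  rw [h.work i hi, ENNReal.ofReal_eq_ofReal_iff (I.w_pos i).le
    (mul_nonneg hv.le (Finset.sum_nonneg fun j _ => Schedule.itvTime_nonneg i j))] at h1
  rw [h1, mul_div_cancel_left₀ _ hv.ne']

lemma WapSchedule.loaded {σ : Schedule n m} (h : S.WapSchedule v σ) (hv : 0 < v) :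
    S.Loaded v := by
  intro A hA
  have h1 := h.fits.sum_le_rank A
  rw [Finset.sum_congr rfl fun i hi => h.sum_itvTime hv (hA hi), ← Finset.sum_div,
    div_le_iff₀ hv] at h1
  linarith

lemma _root_.BAL.Net.IsAssignment.wapSchedule {τ : Fin n → Fin I.L → ℝ}
    (h : (S.net v).IsAssignment τ) (hm : ∀ j, S.mach j ≤ m) (hv : 0 < v) :
    S.WapSchedule v (wrapAround I m τ fun _ => v) where
  valid := h.fits.wrapAround_valid fun _ => hv.le
  mem_jobs p t i hi := by
    obtain ⟨j, -, hτ, -⟩ := h.fits.alive_of_job _ hi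
    by_contra hn
    have := h.le_link i j
    simp only [net, hn, false_and, if_false] at this
    linarith
  speed_eq p t i hi := wrapAround_speed _ hi
  avail j p t i ht hi := by
    obtain ⟨k, hk, -, hp⟩ := h.fits.alive_of_job _ hi
    obtain rfl := I.slot_eq (Set.Ioo_subset_Ico_self ht) hk
    exact hp
  work i hi := by
    rw [h.fits.wrapAround_workDone hm (fun _ => hv.le), h.sum_eq]
    simp only [net, hi, if_true]
    rw [mul_div_cancel₀ _ hv.ne']

lemma Loaded.isAssignment (h : S.Loaded v) (F : MaxFlowAlg) (hv : 0 < v) :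
    (S.net v).IsAssignment fun i j => F.flow (S.net v) (.job i) (.itv j) :=
  (F.correct _ (S.net_nonneg hv.le)).isAssignment_of_hall ((hall_iff_loaded hv).2 h)

theorem exists_wapSchedule_iff (F : MaxFlowAlg) (hm : ∀ j, S.mach j ≤ m) (hv : 0 < v) :
    (∃ σ : Schedule n m, S.WapSchedule v σ) ↔ S.Loaded v :=
  ⟨fun ⟨_, h⟩ => h.loaded hv, fun h => ⟨_, (h.isAssignment F hv).wapSchedule hm hv⟩⟩

theorem wapTest_iff (F : MaxFlowAlg) (hv : 0 < v) :
    (wapTest F S v).1 = true ↔ S.Loaded v := by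
  rw [wapTest, decide_eq_true_iff]
  have hF := F.correct _ (S.net_nonneg hv.le)
  rw [← hall_iff_loaded hv]
  exact ⟨fun h => (hF.1.isAssignment h).sum_supply_le, fun h => hF.value_eq_of_hall h⟩

/-! ### The critical speed -/

lemma sum_w_pos {A : Finset (Fin n)} (h : A.Nonempty) : 0 < ∑ i ∈ A, I.w i :=
  Finset.sum_pos (fun i _ => I.w_pos i) h

lemma rank_nonneg {mach : Fin I.L → ℕ} {A : Finset (Fin n)} : 0 ≤ rank I mach A := by
  rw [← rank_empty (I := I) (mach := mach)]
  exact rank_mono (Finset.empty_subset A)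

lemma Loaded.rank_pos (h : S.Loaded v) {A : Finset (Fin n)} (hA : A ⊆ S.jobs)
    (hne : A.Nonempty) : 0 < rank I S.mach A := by
  refine lt_of_le_of_ne rank_nonneg fun h0 => ?_
  have := h A hA
  rw [← h0, mul_zero] at this
  exact absurd (sum_w_pos hne) (not_lt.2 this)

lemma Loaded.mono (h : S.Loaded v) {u : ℝ} (hu : v ≤ u) : S.Loaded u := fun A hA =>
  (h A hA).trans (mul_le_mul_of_nonneg_right hu rank_nonneg)

/-- A set of remaining jobs that occupies all the capacity it has access to. -/
def IsTight (S : State I) (v : ℝ) (A : Finset (Fin n)) : Prop :=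
  A ⊆ S.jobs ∧ ∑ i ∈ A, I.w i = v * rank I S.mach A

lemma IsTight.le_of_loaded {A : Finset (Fin n)} (h : S.IsTight v A) (hne : A.Nonempty) {u : ℝ}
    (hu : S.Loaded u) : v ≤ u := by
  have h1 := hu A h.1
  rw [h.2] at h1
  exact le_of_mul_le_mul_right h1 (hu.rank_pos h.1 hne)

lemma Loaded.exists_tight {u : ℝ} (h : S.Loaded u) (hne : S.jobs.Nonempty) :
    ∃ v, 0 < v ∧ S.Loaded v ∧ ∃ A, A.Nonempty ∧ S.IsTight v A := by
  obtain ⟨A, hA, hmax⟩ := (S.jobs.powerset.filter Finset.Nonempty).exists_max_image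
    (fun A => (∑ i ∈ A, I.w i) / rank I S.mach A) ⟨S.jobs, by simp [hne]⟩
  simp only [Finset.mem_filter, Finset.mem_powerset, and_imp] at hA hmax
  have hr := h.rank_pos hA.1 hA.2
  refine ⟨_, div_pos (sum_w_pos hA.2) hr, fun B hB => ?_, A, hA.2, hA.1,
    (div_mul_cancel₀ _ hr.ne').symm⟩
  rcases B.eq_empty_or_nonempty with rfl | hB'
  · simp
  · rw [← div_le_iff₀ (h.rank_pos hB hB')]
    exact hmax B hB hB'

lemma isCritSpeed_of_tight (F : MaxFlowAlg) (hm : ∀ j, S.mach j ≤ m) (hv : 0 < v)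
    (h : S.Loaded v) {A : Finset (Fin n)} (hA : S.IsTight v A) (hne : A.Nonempty) :
    S.IsCritSpeed m v :=
  ⟨⟨hv, (exists_wapSchedule_iff F hm hv).2 h⟩,
    fun _ hu => hA.le_of_loaded hne ((exists_wapSchedule_iff F hm hu.1).1 hu.2)⟩

lemma Loaded.exists_isCritSpeed (F : MaxFlowAlg) (hm : ∀ j, S.mach j ≤ m) {u : ℝ}
    (h : S.Loaded u) (hne : S.jobs.Nonempty) : ∃ v, S.IsCritSpeed m v := by
  obtain ⟨v, hv, hl, A, hA, ht⟩ := h.exists_tight hne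
  exact ⟨v, isCritSpeed_of_tight F hm hv hl ht hA⟩

lemma IsCritSpeed.pos (h : S.IsCritSpeed m v) : 0 < v := h.1.1

lemma IsCritSpeed.loaded (h : S.IsCritSpeed m v) : S.Loaded v := by
  obtain ⟨σ, hσ⟩ := h.1.2
  exact hσ.loaded h.pos

lemma IsCritSpeed.exists_tight (F : MaxFlowAlg) (hm : ∀ j, S.mach j ≤ m) (h : S.IsCritSpeed m v)
    (hne : S.jobs.Nonempty) : ∃ A, A.Nonempty ∧ S.IsTight v A := by
  obtain ⟨u, hu, hl, A, hA, ht⟩ := h.loaded.exists_tight hne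
  obtain rfl := h.unique (isCritSpeed_of_tight F hm hu hl ht hA)
  exact ⟨A, hA, ht⟩

lemma IsCritSpeed.le_of_loaded (F : MaxFlowAlg) (hm : ∀ j, S.mach j ≤ m) (h : S.IsCritSpeed m v)
    {u : ℝ} (hu : 0 < u) (hl : S.Loaded u) : v ≤ u :=
  h.2 ⟨hu, (exists_wapSchedule_iff F hm hu).2 hl⟩

lemma IsCritSpeed.loaded_iff (F : MaxFlowAlg) (hm : ∀ j, S.mach j ≤ m) (h : S.IsCritSpeed m v)
    {u : ℝ} (hu : 0 < u) : S.Loaded u ↔ v ≤ u :=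
  ⟨h.le_of_loaded F hm hu, h.loaded.mono⟩

lemma Loaded.den_le (h : S.Loaded v) (hv : 0 ≤ v) {i : Fin n} (hi : i ∈ S.jobs) : I.den i ≤ v := by
  rw [Jobs.den, div_le_iff₀ (sub_pos.2 (I.r_lt_d i))]
  have := h {i} (Finset.singleton_subset_iff.2 hi)
  rw [Finset.sum_singleton] at this
  exact this.trans (mul_le_mul_of_nonneg_left (rank_le_span i) hv)

lemma Loaded.lb_le (h : S.Loaded v) (hv : 0 ≤ v) (hne : S.jobs.Nonempty) : S.lb ≤ v := by
  refine csSup_le ((Finset.coe_nonempty.2 hne).image _) ?_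
  rintro _ ⟨i, hi, rfl⟩
  exact h.den_le hv hi

lemma den_le_lb {i : Fin n} (hi : i ∈ S.jobs) : I.den i ≤ S.lb :=
  le_csSup (S.jobs.finite_toSet.image _).bddAbove ⟨i, hi, rfl⟩

/-! ### The critical jobs form the largest tight set -/

lemma Loaded.union_tight (h : S.Loaded v) (hv : 0 ≤ v) {A B : Finset (Fin n)}
    (hA : S.IsTight v A) (hB : S.IsTight v B) : S.IsTight v (A ∪ B) := by
  have hU := Finset.union_subset hA.1 hB.1
  refine ⟨hU, le_antisymm (h _ hU) ?_⟩
  have h1 := h (A ∩ B) (Finset.inter_subset_left.trans hA.1)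
  have h2 := Finset.sum_union_inter (s₁ := A) (s₂ := B) (f := I.w)
  have h3 := mul_le_mul_of_nonneg_left (rank_submodular (I := I) (mach := S.mach) A B) hv
  rw [hA.2, hB.2] at h2
  linarith

/-- The tight set `T` contains all the others. -/
def IsMaxTight (S : State I) (v : ℝ) (T : Finset (Fin n)) : Prop :=
  S.IsTight v T ∧ ∀ A, S.IsTight v A → A ⊆ T

lemma Loaded.exists_isMaxTight (h : S.Loaded v) (hv : 0 ≤ v) : ∃ T, S.IsMaxTight v T := by
  classical
  obtain ⟨T, hT, hmax⟩ := (Finset.univ.filter (S.IsTight v)).exists_max_image Finset.card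
    ⟨∅, by simp [IsTight]⟩
  simp only [Finset.mem_filter, Finset.mem_univ, true_and] at hT hmax
  refine ⟨T, hT, fun A hA => ?_⟩
  have h1 := Finset.eq_of_subset_of_card_le Finset.subset_union_right
    (hmax _ (h.union_tight hv hA hT))
  rw [h1]
  exact Finset.subset_union_left

/-- The jobs of a tight set are critical: a feasible schedule gives them all the time that the
intervals can offer. -/
lemma IsTight.isCritJob {T : Finset (Fin n)} (hT : S.IsTight v T) (hv : 0 < v) {i : Fin n}
    (hi : i ∈ T) : S.IsCritJob m v i := by
  classical
  intro σ hσ j hj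
  change σ.itvTime I i j = _ ∨ ∑ k, σ.itvTime I k j = _
  have hf := hσ.fits
  have h1 : ∑ j, ∑ k ∈ T, σ.itvTime I k j = rank I S.mach T := by
    rw [Finset.sum_comm, Finset.sum_congr rfl fun k hk => hσ.sum_itvTime hv (hT.1 hk),
      ← Finset.sum_div, hT.2, mul_div_cancel_left₀ _ hv.ne']
  have h2 := (Finset.sum_eq_sum_iff_of_le fun j _ => hf.sum_le_rank_term T j).1 h1 j
    (Finset.mem_univ j)
  rcases le_total (S.mach j) (T ∩ I.aliveSet j).card with hle | hle
  · right
    refine le_antisymm (hf.sum_le j) ?_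
    rw [min_eq_left hle, mul_comm] at h2
    rw [← h2]
    exact Finset.sum_le_sum_of_subset_of_nonneg (Finset.subset_univ _)
      fun k _ _ => hf.nonneg k j
  · left
    rw [min_eq_right hle, ← sum_link] at h2
    have h3 := (Finset.sum_eq_sum_iff_of_le fun k _ => by convert hf.le_len k j).1 h2 i hi
    rw [h3, if_pos hj]

/-- A job outside the largest tight set is not critical: a schedule exists even when its work is
slightly increased, and undoing the increase leaves room in some interval. -/
lemma IsMaxTight.mem_of_isCritJob (F : MaxFlowAlg) (hm : ∀ j, S.mach j ≤ m) (h : S.Loaded v)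
    (hv : 0 < v) {T : Finset (Fin n)} (hT : S.IsMaxTight v T) {i : Fin n} (hi : i ∈ S.jobs)
    (hc : S.IsCritJob m v i) : i ∈ T := by
  classical
  by_contra hiT
  set N := S.net v with hN
  have hhall := (hall_iff_loaded hv).2 h
  -- The supply of the job can be increased by a small `ε`.
  have hε : ∀ A : Finset (Fin n), ∀ᶠ ε in nhdsWithin (0 : ℝ) (Set.Ioi 0),
      ∑ k ∈ A, N.supply k + (if i ∈ A then ε else 0) ≤ N.throughput A := by
    intro A
    by_cases hA : i ∈ A
    · have hlt : ∑ k ∈ A, N.supply k < N.throughput A := by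
        refine lt_of_le_of_ne (hhall A) fun heq => hiT ?_
        rw [hN, sum_supply_net, throughput_net, div_eq_iff hv.ne', mul_comm] at heq
        exact hT.2 _ ⟨Finset.inter_subset_right, heq⟩ (Finset.mem_inter.2 ⟨hA, hi⟩)
      have h1 : ∀ᶠ ε in nhdsWithin (0 : ℝ) (Set.Ioi 0),
          ε < N.throughput A - ∑ k ∈ A, N.supply k :=
        nhdsWithin_le_nhds (gt_mem_nhds (sub_pos.2 hlt))
      filter_upwards [h1] with ε hε
      rw [if_pos hA]
      linarith
    · simp only [hA, if_false, add_zero]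
      exact Filter.Eventually.of_forall fun _ => hhall A
  obtain ⟨ε, hε, hpos⟩ := ((Filter.eventually_all.2 hε).and self_mem_nhdsWithin).exists
  have hpos : 0 < ε := hpos
  have hwi : 0 < I.w i / v := div_pos (I.w_pos i) hv
  have hsup : N.supply i = I.w i / v := by simp [hN, net, hi]
  let N' : Net n I.L := { N with supply := fun k => N.supply k + if k = i then ε else 0 }
  have hN0 := S.net_nonneg hv.le
  have hN' : N'.Nonneg := ⟨fun k => by
    have := hN0.1 k
    change 0 ≤ N.supply k + _
    split_ifs <;> linarith, hN0.2⟩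
  have hτ := (F.correct N' hN').isAssignment_of_hall fun A => by
    change ∑ k ∈ A, (N.supply k + if k = i then ε else 0) ≤ N.throughput A
    rw [Finset.sum_add_distrib, Finset.sum_ite_eq']
    exact hε A
  set τ := fun k j => F.flow N' (.job k) (.itv j)
  -- The execution times of the job are scaled back to its true work.
  set θ := I.w i / v / (I.w i / v + ε) with hθ
  have hθ0 : 0 ≤ θ := by positivity
  have hθ1 : θ < 1 := by rw [hθ, div_lt_one (by positivity)]; linarith
  let τ' : Fin n → Fin I.L → ℝ := fun k j => if k = i then θ * τ k j else τ k j
  have hle : ∀ k j, τ' k j ≤ τ k j := by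
    intro k j
    have := hτ.nonneg k j
    simp only [τ']
    split_ifs
    · nlinarith
    · exact le_rfl
  have hτ' : N.IsAssignment τ' := by
    refine ⟨fun k j => ?_, fun k j => (hle k j).trans (hτ.le_link k j), fun k => ?_,
      fun j => (Finset.sum_le_sum fun k _ => hle k j).trans (hτ.sum_le j)⟩
    · have := hτ.nonneg k j
      simp only [τ']
      split_ifs
      · positivity
      · exact this
    · have h1 : ∑ j, τ k j = N.supply k + if k = i then ε else 0 := hτ.sum_eq k
      by_cases hk : k = i
      · subst hk
        simp only [τ', if_true] at h1 ⊢
        rw [← Finset.mul_sum, h1, hsup, hθ]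
        exact div_mul_cancel₀ _ (by positivity)
      · simpa [τ', hk] using h1
  have hsum : 0 < ∑ j, τ i j := by
    have h1 : ∑ j, τ i j = N.supply i + if i = i then ε else 0 := hτ.sum_eq i
    rw [h1, if_pos rfl, hsup]
    positivity
  obtain ⟨j, -, hj⟩ := Finset.exists_lt_of_sum_lt
    (show ∑ j : Fin I.L, (0 : ℝ) < ∑ j, τ i j by simpa using hsum)
  have hlt : τ' i j < τ i j := by simp only [τ', if_true]; nlinarith
  have hW := hτ'.wapSchedule hm hv
  have hfit : Fits I S.mach τ :=
    ⟨hτ.nonneg, fun k j => (hτ.le_link k j).trans (by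
      simp only [N', hN, net]
      have := (I.len_pos j).le
      by_cases h1 : k ∈ S.jobs <;> by_cases h2 : I.Alive k j <;> simp [h1, h2, this]),
      hτ.sum_le⟩
  have h1 := hc _ hW j (hfit.alive hj)
  change Schedule.itvTime I _ i j = _ ∨ ∑ k, Schedule.itvTime I _ k j = _ at h1
  simp only [hτ'.fits.itvTime_wrapAround hm] at h1
  rcases h1 with h1 | h1
  · have := hfit.le_len' i j
    linarith
  · have h2 := hfit.sum_le j
    have h3 : ∑ k, τ' k j < ∑ k, τ k j :=
      Finset.sum_lt_sum (fun k _ => hle k j) ⟨i, Finset.mem_univ i, hlt⟩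
    linarith

theorem IsMaxTight.critJobs_eq (F : MaxFlowAlg) (hm : ∀ j, S.mach j ≤ m) (h : S.Loaded v)
    (hv : 0 < v) {T : Finset (Fin n)} (hT : S.IsMaxTight v T) : S.critJobs m v = T := by
  ext i
  simp only [critJobs, Finset.mem_filter]
  exact ⟨fun hi => hT.mem_of_isCritJob F hm h hv hi.1 hi.2,
    fun hi => ⟨hT.1.1 hi, hT.1.isCritJob hv hi⟩⟩

theorem IsCritSpeed.isMaxTight_critJobs (F : MaxFlowAlg) (hm : ∀ j, S.mach j ≤ m)
    (h : S.IsCritSpeed m v) : S.IsMaxTight v (S.critJobs m v) := by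
  obtain ⟨T, hT⟩ := h.loaded.exists_isMaxTight h.pos.le
  rwa [hT.critJobs_eq F hm h.loaded h.pos]

lemma IsCritSpeed.critJobs_nonempty (F : MaxFlowAlg) (hm : ∀ j, S.mach j ≤ m)
    (h : S.IsCritSpeed m v) (hne : S.jobs.Nonempty) : (S.critJobs m v).Nonempty := by
  obtain ⟨A, hA, hA'⟩ := h.exists_tight F hm hne
  exact hA.mono ((h.isMaxTight_critJobs F hm).2 A hA')

/-! ### Removing the critical jobs -/

lemma rank_remove {T B : Finset (Fin n)} (hB : Disjoint T B) :
    rank I (S.remove T v).mach B = rank I S.mach (T ∪ B) - rank I S.mach T :=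
  rank_contract hB fun _ => rfl

lemma disjoint_of_subset_remove {T B : Finset (Fin n)} (hB : B ⊆ (S.remove T v).jobs) :
    Disjoint T B := Finset.disjoint_of_subset_right hB Finset.disjoint_sdiff

lemma IsTight.loaded_remove {T : Finset (Fin n)} (hT : S.IsTight v T) (h : S.Loaded v) :
    (S.remove T v).Loaded v := by
  intro B hB
  have hd := disjoint_of_subset_remove hB
  have h1 := h (T ∪ B) (Finset.union_subset hT.1 (hB.trans Finset.sdiff_subset))
  rw [Finset.sum_union hd, hT.2] at h1
  rw [rank_remove hd]
  linarith

lemma IsMaxTight.sum_lt {T B : Finset (Fin n)} (hT : S.IsMaxTight v T) (h : S.Loaded v)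
    (hB : B ⊆ (S.remove T v).jobs) (hne : B.Nonempty) :
    ∑ i ∈ B, I.w i < v * rank I (S.remove T v).mach B := by
  refine lt_of_le_of_ne (hT.1.loaded_remove h B hB) fun heq => ?_
  have hd := disjoint_of_subset_remove hB
  rw [rank_remove hd] at heq
  have h1 : S.IsTight v (T ∪ B) := by
    refine ⟨Finset.union_subset hT.1.1 (hB.trans Finset.sdiff_subset), ?_⟩
    rw [Finset.sum_union hd, hT.1.2, heq]
    ring
  obtain ⟨i, hi⟩ := hne
  exact Finset.disjoint_left.1 hd (hT.2 _ h1 (Finset.mem_union_right _ hi)) hi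

lemma IsMaxTight.next_lt (F : MaxFlowAlg) (hm : ∀ j, S.mach j ≤ m) {T : Finset (Fin n)}
    (hT : S.IsMaxTight v T) (h : S.Loaded v) {u : ℝ} (hne : (S.remove T v).jobs.Nonempty)
    (hu : (S.remove T v).IsCritSpeed m u) : u < v := by
  have hm' : ∀ j, (S.remove T v).mach j ≤ m := fun j => (Nat.sub_le _ _).trans (hm j)
  obtain ⟨A, hA, hA'⟩ := hu.exists_tight F hm' hne
  have h1 := hT.sum_lt h hA'.1 hA
  rw [hA'.2] at h1
  exact lt_of_mul_lt_mul_right h1 rank_nonneg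

/-- For a speed between the critical speed of the instance without the jobs of `T` and the critical
speed, the set `T` is the only minimizer of the excess capacity. -/
lemma IsMaxTight.eq_of_minimizer {T B : Finset (Fin n)} (hT : S.IsMaxTight v T) (h : S.Loaded v)
    {v' : ℝ} (hv' : 0 < v') (hlt : v' < v)
    (hnext : ∀ A ⊆ (S.remove T v).jobs, A.Nonempty →
      ∑ i ∈ A, I.w i < v' * rank I (S.remove T v).mach A)
    (hB : B ⊆ S.jobs)
    (hmin : ∀ A ⊆ S.jobs, v' * rank I S.mach B - ∑ i ∈ B, I.w i ≤
      v' * rank I S.mach A - ∑ i ∈ A, I.w i) : B = T := by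
  have hsub : T ⊆ B := by
    have h1 := hmin (B ∪ T) (Finset.union_subset hB hT.1.1)
    have h2 := mul_le_mul_of_nonneg_left (rank_submodular (I := I) (mach := S.mach) B T) hv'.le
    have h3 := Finset.sum_union_inter (s₁ := B) (s₂ := T) (f := I.w)
    have h4 := h (B ∩ T) (Finset.inter_subset_left.trans hB)
    have h5 := hT.1.2
    rw [mul_add, mul_add] at h2
    have h6 : (v - v') * rank I S.mach T ≤ (v - v') * rank I S.mach (B ∩ T) := by linarith
    have h7 := mul_le_mul_of_nonneg_left (le_of_mul_le_mul_left h6 (sub_pos.2 hlt)) hv'.le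
    have h8 : ∑ i ∈ T, I.w i ≤ ∑ i ∈ B ∩ T, I.w i := by linarith
    by_contra hn
    have h9 := Finset.sum_sdiff (f := I.w) (Finset.inter_subset_right (s₁ := B) (s₂ := T))
    have h10 : (T \ (B ∩ T)).Nonempty := by
      rw [Finset.sdiff_nonempty]
      exact fun h => hn (h.trans Finset.inter_subset_left)
    linarith [sum_w_pos (I := I) h10]
  by_contra hne
  have hd : Disjoint T (B \ T) := Finset.disjoint_sdiff
  have h1 := hnext (B \ T) (Finset.sdiff_subset_sdiff hB le_rfl)
    (Finset.sdiff_nonempty.2 fun h => hne (Finset.Subset.antisymm h hsub))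
  rw [rank_remove hd, Finset.union_sdiff_of_subset hsub] at h1
  have h2 := hmin T hT.1.1
  have h3 := Finset.sum_sdiff (f := I.w) hsub
  linarith

/-- A minimum cut for such a speed has exactly the critical jobs on its source side. -/
theorem IsCritSpeed.cut_jobs_eq (F : MaxFlowAlg) (hm : ∀ j, S.mach j ≤ m)
    (h : S.IsCritSpeed m v) {v' : ℝ} (hv' : 0 < v') (hlt : v' < v)
    (hnext : ∀ u, (S.remove (S.critJobs m v) v).IsCritSpeed m u → u < v')
    {X : Finset (Node n I.L)} (hX : IsMinCut (S.net v').cap .src .snk X) :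
    Net.jobSide X ∩ S.jobs = S.critJobs m v := by
  have hT := h.isMaxTight_critJobs F hm
  have hm' : ∀ j, (S.remove (S.critJobs m v) v).mach j ≤ m := fun j =>
    (Nat.sub_le _ _).trans (hm j)
  refine hT.eq_of_minimizer h.loaded hv' hlt (fun A hA hne => ?_) Finset.inter_subset_right
    fun A hA => ?_
  · have hl := hT.1.loaded_remove h.loaded
    obtain ⟨u, hu⟩ := hl.exists_isCritSpeed F hm' (hne.mono hA)
    refine (hu.loaded A hA).trans_lt ?_
    exact mul_lt_mul_of_pos_right (hnext u hu) (hl.rank_pos hA hne)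
  · have h1 := hX.jobCut_le A
    rw [Net.jobCut, Net.jobCut, throughput_net, throughput_net, Finset.inter_eq_left.2 hA] at h1
    have h2 : ∀ B : Finset (Fin n), v' * ∑ i ∈ Bᶜ, (S.net v').supply i =
        ∑ i ∈ S.jobs, I.w i - ∑ i ∈ B ∩ S.jobs, I.w i := by
      intro B
      have h3 : Bᶜ ∩ S.jobs = S.jobs \ (B ∩ S.jobs) := by ext i; simp; tauto
      rw [sum_supply_net, mul_div_cancel₀ _ hv'.ne', eq_sub_iff_add_eq, h3]
      exact Finset.sum_sdiff Finset.inter_subset_right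
    have h3 := mul_le_mul_of_nonneg_left h1 hv'.le
    rw [mul_add, mul_add, h2, h2, Finset.inter_eq_left.2 hA] at h3
    linarith

end State

/-! ### The iterations of the algorithm -/

section Step

variable {n m : ℕ} {I : Jobs n} {S S' : State I} {F : MaxFlowAlg} {δ : ℝ} {c : ℕ}

/-- Whatever choices are made, an iteration removes exactly the critical jobs. -/
theorem Step.eq_remove (hm : ∀ j, S.mach j ≤ m) (h : Step F m δ S S' c) :
    ∃ v, S.IsCritSpeed m v ∧ S' = S.remove (S.critJobs m v) v := by
  obtain ⟨-, v, v', X, hv, hv', hlt, hnext, hX, rfl, -⟩ := h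
  refine ⟨v, hv, ?_⟩
  rw [← hv.cut_jobs_eq F hm hv' hlt hnext hX]
  congr 1
  ext i
  simp [Net.jobSide, and_comm]

theorem exists_step (hm : ∀ j, S.mach j ≤ m) {u : ℝ} (hl : S.Loaded u) (hne : S.jobs.Nonempty) :
    ∃ S' c, Step F m δ S S' c := by
  obtain ⟨v, hv⟩ := hl.exists_isCritSpeed F hm hne
  have hT := hv.isMaxTight_critJobs F hm
  have hm' : ∀ j, (S.remove (S.critJobs m v) v).mach j ≤ m := fun j =>
    (Nat.sub_le _ _).trans (hm j)
  obtain ⟨v', hv', hlt, hnext⟩ : ∃ v', 0 < v' ∧ v' < v ∧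
      ∀ u, (S.remove (S.critJobs m v) v).IsCritSpeed m u → u < v' := by
    rcases Finset.eq_empty_or_nonempty (S.remove (S.critJobs m v) v).jobs with he | hne'
    · refine ⟨v / 2, half_pos hv.pos, half_lt_self hv.pos, fun u hu => ?_⟩
      -- Without jobs every positive speed is feasible, so there is no critical speed.
      have := hu.le_of_loaded F hm' (half_pos hu.pos) fun A hA => by
        rw [he, Finset.subset_empty] at hA
        simp [hA]
      linarith [hu.pos]
    · obtain ⟨u, hu⟩ := (hT.1.loaded_remove hv.loaded).exists_isCritSpeed F hm' hne'
      have := hT.next_lt F hm hv.loaded hne' hu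
      refine ⟨(u + v) / 2, by linarith [hu.pos], by linarith, fun u' hu' => ?_⟩
      rw [hu'.unique hu]
      linarith
  obtain ⟨X, hX⟩ := Net.exists_isMinCut (S.net v')
  exact ⟨_, _, hne, v, v', X, hv, hv', hlt, hnext, hX, rfl, rfl⟩

theorem Step.jobs_ssubset (hm : ∀ j, S.mach j ≤ m) (h : Step F m δ S S' c) :
    S'.jobs ⊂ S.jobs := by
  obtain ⟨v, hv, rfl⟩ := h.eq_remove hm
  exact Finset.sdiff_ssubset (hv.isMaxTight_critJobs F hm).1.1 (hv.critJobs_nonempty F hm h.1)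

end Step

/-! ### The invariant -/

section Invariant

variable {n m : ℕ} {I : Jobs n} {S S' : State I} {F : MaxFlowAlg} {δ α : ℝ} {c : ℕ}

/-- The invariant of the algorithm. The execution times `w i / speed i` of the removed jobs form a
base of the polymatroid restricted to these jobs, and `exchange` says that they maximize, over the
polymatroid, the linear function with weights `speed i ^ α - ub ^ α`. -/
structure Invariant (m : ℕ) (α : ℝ) (S : State I) : Prop where
  ub_pos : 0 < S.ub
  ub_le : S.ub ≤ I.sUB
  loaded : S.Loaded S.ub
  mach_eq : ∀ j, S.mach j = m - (S.jobsᶜ ∩ I.aliveSet j).card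
  speed_pos : ∀ i, i ∉ S.jobs → 0 < S.speed i
  hall : ∀ A, Disjoint A S.jobs → ∑ i ∈ A, I.w i / S.speed i ≤ rank I (fun _ => m) A
  hall_eq : ∑ i ∈ S.jobsᶜ, I.w i / S.speed i = rank I (fun _ => m) S.jobsᶜ
  exchange : ∀ x : Fin n → ℝ, (∀ A, ∑ i ∈ A, x i ≤ rank I (fun _ => m) A) →
    0 ≤ ∑ i ∈ S.jobsᶜ, (S.speed i ^ α - S.ub ^ α) * (I.w i / S.speed i - x i)

lemma Invariant.mach_le (h : Invariant m α S) (j : Fin I.L) : S.mach j ≤ m := by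
  rw [h.mach_eq]
  exact Nat.sub_le _ _

lemma Jobs.den_pos (I : Jobs n) (i : Fin n) : 0 < I.den i :=
  div_pos (I.w_pos i) (sub_pos.2 (I.r_lt_d i))

lemma Jobs.den_le_sUB (I : Jobs n) (i : Fin n) : I.den i ≤ I.sUB :=
  (le_ciSup (Set.finite_range I.den).bddAbove i).trans (le_max_right _ _)

lemma Jobs.sum_alive_le (I : Jobs n) (j : Fin I.L) :
    (∑ i ∈ I.aliveSet j, I.w i) / I.len j ≤ I.sUB :=
  (le_ciSup (f := fun j => (∑ i ∈ I.aliveSet j, I.w i) / I.len j)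
    (Set.finite_range _).bddAbove j).trans (le_max_left _ _)

/-- At the speed `sUB` even a single processor suffices: every job can be spread evenly over its
life span. -/
lemma loaded_init (hm : 0 < m) : (init I m).Loaded I.sUB := by
  classical
  intro A _
  have h1 : ∀ i, I.w i = ∑ j, I.den i * if I.Alive i j then I.len j else 0 := by
    intro i
    rw [← Finset.mul_sum, I.sum_len, Jobs.den, div_mul_cancel₀ _ (sub_pos.2 (I.r_lt_d i)).ne']
  rw [Finset.sum_congr rfl fun i _ => h1 i, Finset.sum_comm, rank, Finset.mul_sum]
  refine Finset.sum_le_sum fun j _ => ?_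
  have h2 : ∑ i ∈ A, I.den i * (if I.Alive i j then I.len j else 0) =
      I.len j * ∑ i ∈ A ∩ I.aliveSet j, I.den i := by
    rw [Jobs.aliveSet, Finset.inter_filter, Finset.inter_univ, Finset.sum_filter, Finset.mul_sum]
    refine Finset.sum_congr rfl fun i _ => ?_
    split_ifs <;> ring
  rw [h2, mul_left_comm]
  refine mul_le_mul_of_nonneg_left ?_ (I.len_pos j).le
  change _ ≤ I.sUB * ((min m (A ∩ I.aliveSet j).card : ℕ) : ℝ)
  rcases (A ∩ I.aliveSet j).eq_empty_or_nonempty with he | ⟨i₀, hi₀⟩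
  · simp [he]
  have hU : 0 ≤ I.sUB := (I.den_pos i₀).le.trans (I.den_le_sUB i₀)
  rcases le_total m (A ∩ I.aliveSet j).card with hle | hle
  · rw [min_eq_left hle]
    have h3 : ∑ i ∈ A ∩ I.aliveSet j, I.den i ≤ (∑ i ∈ I.aliveSet j, I.w i) / I.len j := by
      rw [Finset.sum_div]
      refine (Finset.sum_le_sum_of_subset_of_nonneg Finset.inter_subset_right
        fun i _ _ => (I.den_pos i).le).trans (Finset.sum_le_sum fun i hi => ?_)
      exact div_le_div_of_nonneg_left (I.w_pos i).le (I.len_pos j) (mem_aliveSet.1 hi).len_le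
    refine (h3.trans (I.sum_alive_le j)).trans (le_mul_of_one_le_right hU ?_)
    exact_mod_cast hm
  · rw [min_eq_right hle, mul_comm, ← nsmul_eq_mul, ← Finset.sum_const]
    exact Finset.sum_le_sum fun i _ => I.den_le_sUB i

theorem invariant_init (hn : 0 < n) (hm : 0 < m) : Invariant m α (init I m) where
  ub_pos := (I.den_pos ⟨0, hn⟩).trans_le (I.den_le_sUB _)
  ub_le := le_rfl
  loaded := loaded_init hm
  mach_eq j := by simp [init]
  speed_pos i hi := absurd (Finset.mem_univ i) hi
  hall A hA := by
    have : A = ∅ := Finset.eq_empty_of_forall_notMem fun i hi =>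
      Finset.disjoint_left.1 hA hi (Finset.mem_univ i)
    simp [this]
  hall_eq := by simp [init]
  exchange x _ := by simp [init]

lemma Invariant.rank_eq (h : Invariant m α S) {B : Finset (Fin n)} (hB : B ⊆ S.jobs) :
    rank I S.mach B = rank I (fun _ => m) (S.jobsᶜ ∪ B) - rank I (fun _ => m) S.jobsᶜ :=
  rank_contract (Finset.disjoint_of_subset_right hB disjoint_compl_left) h.mach_eq

lemma compl_remove {T : Finset (Fin n)} {v : ℝ} :
    (S.remove T v).jobsᶜ = S.jobsᶜ ∪ T := by
  ext i
  simp only [State.remove, Finset.mem_compl, Finset.mem_sdiff, Finset.mem_union]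
  tauto

lemma sum_remove_speed {T A : Finset (Fin n)} {v : ℝ} (hA : Disjoint A T) (g : Fin n → ℝ → ℝ) :
    ∑ i ∈ A, g i ((S.remove T v).speed i) = ∑ i ∈ A, g i (S.speed i) := by
  refine Finset.sum_congr rfl fun i hi => ?_
  simp only [State.remove, if_neg (Finset.disjoint_left.1 hA hi)]

lemma sum_remove_speed' {T A : Finset (Fin n)} {v : ℝ} (hA : A ⊆ T) (g : Fin n → ℝ → ℝ) :
    ∑ i ∈ A, g i ((S.remove T v).speed i) = ∑ i ∈ A, g i v := by
  refine Finset.sum_congr rfl fun i hi => ?_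
  simp only [State.remove, if_pos (hA hi)]

theorem Invariant.remove (h : Invariant m α S) (hα : 0 < α) {v : ℝ} (hv : 0 < v)
    (hvu : v ≤ S.ub) (hl : S.Loaded v) {T : Finset (Fin n)} (hT : S.IsTight v T) :
    Invariant m α (S.remove T v) where
  ub_pos := hv
  ub_le := hvu.trans h.ub_le
  loaded := hT.loaded_remove hl
  mach_eq j := by
    have hd : Disjoint (S.jobsᶜ ∩ I.aliveSet j) (T ∩ I.aliveSet j) :=
      (Finset.disjoint_of_subset_right hT.1 disjoint_compl_left).mono
        Finset.inter_subset_left Finset.inter_subset_left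
    rw [compl_remove, Finset.union_inter_distrib_right, Finset.card_union_of_disjoint hd,
      ← Nat.sub_sub, ← h.mach_eq]
    rfl
  speed_pos i hi := by
    have h1 : i ∈ S.jobsᶜ ∪ T := by rwa [← compl_remove (v := v), Finset.mem_compl]
    simp only [State.remove]
    split_ifs with hiT
    · exact hv
    · exact h.speed_pos i (by simpa [hiT] using h1)
  hall A hA := by
    have hAU : A \ T = A ∩ S.jobsᶜ := by
      ext i
      have h1 : i ∈ A → i ∉ (S.remove T v).jobs := fun h => Finset.disjoint_left.1 hA h
      have h2 : i ∈ T → i ∈ S.jobs := fun h => hT.1 h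
      simp only [State.remove, Finset.mem_sdiff, Finset.mem_inter, Finset.mem_compl] at h1 ⊢
      tauto
    have hUA : S.jobsᶜ ∪ (A ∩ T) = A ∪ S.jobsᶜ := by
      ext i
      have h1 : i ∈ A → i ∉ (S.remove T v).jobs := fun h => Finset.disjoint_left.1 hA h
      simp only [State.remove, Finset.mem_sdiff, Finset.mem_inter, Finset.mem_compl,
        Finset.mem_union] at h1 ⊢
      tauto
    rw [← Finset.sum_inter_add_sum_sdiff A T, add_comm,
      sum_remove_speed Finset.sdiff_disjoint fun i s => I.w i / s,
      sum_remove_speed' Finset.inter_subset_right fun i s => I.w i / s, ← Finset.sum_div]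
    have h1 := h.hall (A \ T) (by
      rw [hAU]
      exact disjoint_compl_left.mono_left Finset.inter_subset_right)
    have h2 := hl (A ∩ T) (Finset.inter_subset_right.trans hT.1)
    rw [mul_comm, ← div_le_iff₀ hv, h.rank_eq (Finset.inter_subset_right.trans hT.1), hUA] at h2
    have h3 := rank_submodular (I := I) (mach := fun _ => m) A S.jobsᶜ
    rw [hAU] at h1 ⊢
    linarith
  hall_eq := by
    have hd : Disjoint S.jobsᶜ T := Finset.disjoint_of_subset_right hT.1 disjoint_compl_left
    rw [compl_remove, Finset.sum_union hd, sum_remove_speed hd fun i s => I.w i / s,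
      sum_remove_speed' le_rfl fun i s => I.w i / s, h.hall_eq, ← Finset.sum_div, hT.2,
      mul_div_cancel_left₀ _ hv.ne', h.rank_eq hT.1]
    ring
  exchange x hx := by
    have hd : Disjoint S.jobsᶜ T := Finset.disjoint_of_subset_right hT.1 disjoint_compl_left
    rw [compl_remove, Finset.sum_union hd,
      sum_remove_speed hd fun i s => (s ^ α - (S.remove T v).ub ^ α) * (I.w i / s - x i),
      sum_remove_speed' le_rfl fun i s => (s ^ α - (S.remove T v).ub ^ α) * (I.w i / s - x i)]
    change 0 ≤ ∑ i ∈ S.jobsᶜ, (S.speed i ^ α - v ^ α) * (I.w i / S.speed i - x i) +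
      ∑ i ∈ T, (v ^ α - v ^ α) * (I.w i / v - x i)
    have h1 : ∑ i ∈ S.jobsᶜ, (S.speed i ^ α - v ^ α) * (I.w i / S.speed i - x i) =
        ∑ i ∈ S.jobsᶜ, (S.speed i ^ α - S.ub ^ α) * (I.w i / S.speed i - x i) +
        (S.ub ^ α - v ^ α) * (∑ i ∈ S.jobsᶜ, I.w i / S.speed i - ∑ i ∈ S.jobsᶜ, x i) := by
      rw [← Finset.sum_sub_distrib, Finset.mul_sum, ← Finset.sum_add_distrib]
      exact Finset.sum_congr rfl fun i _ => by ring
    have h2 := Real.rpow_le_rpow hv.le hvu hα.le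
    have h3 : 0 ≤ (S.ub ^ α - v ^ α) *
        (∑ i ∈ S.jobsᶜ, I.w i / S.speed i - ∑ i ∈ S.jobsᶜ, x i) := by
      rw [h.hall_eq]
      exact mul_nonneg (sub_nonneg.2 h2) (sub_nonneg.2 (hx _))
    have h4 := h.exchange x hx
    simp only [sub_self, zero_mul, Finset.sum_const_zero]
    linarith

theorem Run.invariant (hn : 0 < n) (hm : 0 < m) (hα : 0 < α)
    (h : Run F m δ (init I m) S c) : Invariant m α S := by
  induction h with
  | refl => exact invariant_init hn hm
  | tail _ hstep ih =>
    obtain ⟨v, hv, rfl⟩ := hstep.eq_remove ih.mach_le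
    exact ih.remove hα hv.pos (hv.le_of_loaded F ih.mach_le ih.ub_pos ih.loaded) hv.loaded
      (hv.isMaxTight_critJobs F ih.mach_le).1

/-! ### Optimality of the output -/

lemma finalNet_throughput {s : Fin n → ℝ} (A : Finset (Fin n)) :
    (finalNet I m s).throughput A = rank I (fun _ => m) A := by
  classical
  rw [Net.throughput, rank]
  refine Finset.sum_congr rfl fun j _ => ?_
  exact min_drain_link (mach := fun _ => m) A j

lemma finalNet_nonneg {s : Fin n → ℝ} (hs : ∀ i, 0 < s i) : (finalNet I m s).Nonneg := by
  refine ⟨fun i => (div_pos (I.w_pos i) (hs i)).le, fun i j => ?_,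
    fun j => mul_nonneg (Nat.cast_nonneg _) (I.len_pos j).le⟩
  simp only [finalNet]
  split_ifs
  · exact (I.len_pos j).le
  · exact le_rfl

lemma Net.IsAssignment.fits_final {s : Fin n → ℝ} {τ : Fin n → Fin I.L → ℝ}
    (h : (finalNet I m s).IsAssignment τ) : Fits I (fun _ => m) τ where
  nonneg := h.nonneg
  le_len i j := by
    refine (h.le_link i j).trans (le_of_eq ?_)
    simp only [finalNet]
  sum_le := h.sum_le

/-- The tangent of `y ↦ y ^ α` at `s`. -/
lemma tangent_le_rpow {s y : ℝ} (hs : 0 < s) (hy : 0 ≤ y) (hα : 1 ≤ α) :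
    α * s ^ (α - 1) * y ≤ y ^ α + (α - 1) * s ^ α := by
  have h1 := one_add_mul_self_le_rpow_one_add (s := y / s - 1) (by linarith [div_nonneg hy hs.le])
    hα
  rw [add_sub_cancel, Real.div_rpow hy hs.le, le_div_iff₀ (Real.rpow_pos_of_pos hs α)] at h1
  rw [Real.rpow_sub_one hs.ne']
  have h2 : (1 + α * (y / s - 1)) * s ^ α = α * (s ^ α / s) * y - (α - 1) * s ^ α := by
    field_simp
    ring
  linarith

/-- A lower bound for the energy of a feasible schedule: the power function is replaced by its
tangents at prescribed speeds. -/
theorem Schedule.Feasible.le_energy {σ : Schedule n m} (h : σ.Feasible I) (hα : 1 ≤ α)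
    {s : Fin n → ℝ} (hs : ∀ i, 0 < s i) :
    ENNReal.ofReal (∑ i, α * s i ^ (α - 1) * I.w i) ≤
      σ.energy α + ENNReal.ofReal (∑ i, (α - 1) * s i ^ α * ∑ j, σ.itvTime I i j) := by
  obtain ⟨hv, hw⟩ := h
  have hsα : ∀ i, 0 ≤ s i ^ α := fun i => Real.rpow_nonneg (hs i).le _
  have hsα' : ∀ i, 0 ≤ α * s i ^ (α - 1) := fun i =>
    mul_nonneg (by linarith) (Real.rpow_nonneg (hs i).le _)
  have hα1 : 0 ≤ α - 1 := by linarith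
  rw [ENNReal.ofReal_sum_of_nonneg fun i _ => mul_nonneg (hsα' i) (I.w_pos i).le,
    ENNReal.ofReal_sum_of_nonneg fun i _ => mul_nonneg (mul_nonneg hα1 (hsα i))
      (Finset.sum_nonneg fun j _ => Schedule.itvTime_nonneg i j)]
  have h1 : ∀ i, ENNReal.ofReal (α * s i ^ (α - 1) * I.w i) =
      ∑ p, ∫⁻ t in σ.runs p i, ENNReal.ofReal (α * s i ^ (α - 1) * σ.speed p t) := by
    intro i
    rw [ENNReal.ofReal_mul (hsα' i), ← hw i, Schedule.workDone, Finset.mul_sum]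
    refine Finset.sum_congr rfl fun p _ => ?_
    simp only [ENNReal.ofReal_mul (hsα' i)]
    rw [lintegral_const_mul _ (hv.measurable_speed p).ennreal_ofReal]
  have h2 : ∀ i, ENNReal.ofReal ((α - 1) * s i ^ α * ∑ j, σ.itvTime I i j) =
      ∑ p, ∫⁻ _ in σ.runs p i, ENNReal.ofReal ((α - 1) * s i ^ α) := by
    intro i
    rw [ENNReal.ofReal_mul (mul_nonneg hα1 (hsα i)), ← hv.sum_volume_runs, Finset.mul_sum]
    exact Finset.sum_congr rfl fun p _ => (setLIntegral_const _ _).symm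
  have h3 : ∑ p, ∑ i, ∫⁻ t in σ.runs p i, ENNReal.ofReal (σ.speed p t ^ α) ≤ σ.energy α := by
    refine Finset.sum_le_sum fun p _ => ?_
    rw [← lintegral_biUnion_finset]
    · exact setLIntegral_le_lintegral _ _
    · intro i _ k _ hik
      rw [Function.onFun, Set.disjoint_left]
      intro t h1 h2
      exact hik (Option.some.inj (h1.symm.trans h2))
    · exact fun i _ => hv.measurable_runs p i
  refine le_trans ?_ (add_le_add_left h3 _)
  simp only [h1, h2]
  rw [Finset.sum_comm, Finset.sum_comm (f := fun i p => ∫⁻ _ in σ.runs p i, _),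
    ← Finset.sum_add_distrib]
  refine Finset.sum_le_sum fun p _ => ?_
  rw [← Finset.sum_add_distrib]
  refine Finset.sum_le_sum fun i _ => ?_
  rw [← lintegral_add_right _ measurable_const]
  refine lintegral_mono fun t => ?_
  have hy := hv.speed_nonneg p t
  rw [← ENNReal.ofReal_add (Real.rpow_nonneg hy _) (mul_nonneg hα1 (hsα i))]
  exact ENNReal.ofReal_le_ofReal (tangent_le_rpow (hs i) hy hα)

theorem Invariant.output_optimal (h : Invariant m α S) (hα : 1 < α) (he : S.jobs = ∅) :
    (output F m S).Optimal I α := by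
  have hs : ∀ i, 0 < S.speed i := fun i => h.speed_pos i (by simp [he])
  have hs0 : ∀ i, 0 ≤ S.speed i := fun i => (hs i).le
  have hA := (F.correct _ (finalNet_nonneg (I := I) (m := m) hs)).isAssignment_of_hall fun A => by
    rw [finalNet_throughput]
    exact h.hall A (by simp [he])
  have hfit := hA.fits_final
  have hsum : ∀ i, ∑ j, F.flow (finalNet I m S.speed) (.job i) (.itv j) = I.w i / S.speed i :=
    hA.sum_eq
  refine ⟨⟨hfit.wrapAround_valid hs0, fun i => ?_⟩, fun σ hσ => ?_⟩
  · rw [output, hfit.wrapAround_workDone (fun _ => le_rfl) hs0, hsum, mul_div_cancel₀ _ (hs i).ne']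
  · rw [output, hfit.wrapAround_energy (fun _ => le_rfl) hs0 (by linarith)]
    simp only [hsum]
    have h1 := hσ.le_energy hα.le hs
    refine le_trans ?_ (tsub_le_iff_right.2 h1)
    rw [← ENNReal.ofReal_sub _ (Finset.sum_nonneg fun i _ =>
      mul_nonneg (mul_nonneg (by linarith) (Real.rpow_nonneg (hs0 i) _))
        (Finset.sum_nonneg fun j _ => Schedule.itvTime_nonneg i j))]
    refine ENNReal.ofReal_le_ofReal ?_
    set x : Fin n → ℝ := fun i => ∑ j, σ.itvTime I i j with hx
    have hxr : ∀ A, ∑ i ∈ A, x i ≤ rank I (fun _ => m) A := hσ.1.fits_const.sum_le_rank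
    have h2 := h.exchange x hxr
    have h3 := h.hall_eq
    have h4 := hxr Finset.univ
    rw [he, Finset.compl_empty] at h2 h3
    rw [← h3] at h4
    have h5 : ∑ i, (S.speed i ^ α - S.ub ^ α) * (I.w i / S.speed i - x i) =
        ∑ i, S.speed i ^ α * (I.w i / S.speed i) - ∑ i, S.speed i ^ α * x i -
          S.ub ^ α * (∑ i, I.w i / S.speed i - ∑ i, x i) := by
      rw [← Finset.sum_sub_distrib, ← Finset.sum_sub_distrib, Finset.mul_sum,
        ← Finset.sum_sub_distrib]
      exact Finset.sum_congr rfl fun i _ => by ring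
    have h6 : 0 ≤ S.ub ^ α * (∑ i, I.w i / S.speed i - ∑ i, x i) :=
      mul_nonneg (Real.rpow_nonneg h.ub_pos.le _) (sub_nonneg.2 h4)
    have h7 : ∑ i, α * S.speed i ^ (α - 1) * I.w i =
        α * ∑ i, S.speed i ^ α * (I.w i / S.speed i) := by
      rw [Finset.mul_sum]
      refine Finset.sum_congr rfl fun i _ => ?_
      rw [Real.rpow_sub_one (hs i).ne']
      ring
    have h8 : ∑ i, (α - 1) * S.speed i ^ α * x i = (α - 1) * ∑ i, S.speed i ^ α * x i := by
      rw [Finset.mul_sum]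
      exact Finset.sum_congr rfl fun i _ => by ring
    rw [h7, h8]
    have h9 : 0 ≤ (α - 1) * (∑ i, S.speed i ^ α * (I.w i / S.speed i) -
        ∑ i, S.speed i ^ α * x i) := mul_nonneg (by linarith) (by linarith)
    linarith

end Invariant

/-! ### Binary search -/

theorem bisect_fst {test : ℕ → Bool × ℕ} {k : ℕ} (a b : ℕ) (ha : a ≤ k) (hb : k ≤ b)
    (h : ∀ l, a ≤ l → ((test l).1 = true ↔ k ≤ l)) : (bisect test a b).1 = k := by
  induction a, b using bisect.induct test with
  | case1 a b hab ht ih =>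
    rw [bisect, if_pos hab, if_pos ht]
    exact ih ha ((h _ (by omega)).1 ht) h
  | case2 a b hab ht ih =>
    rw [bisect, if_pos hab, if_neg ht]
    have := mt (h ((a + b) / 2) (by omega)).2 ht
    exact ih (by omega) hb fun l hl => h l (by omega)
  | case3 a b hab =>
    rw [bisect, if_neg hab]
    omega

/-- Each test halves the range of the search. -/
theorem bisect_snd_le {test : ℕ → Bool × ℕ} {K : ℕ} (h : ∀ l, (test l).2 ≤ K) (e a b : ℕ)
    (hab : b - a < 2 ^ e) : (bisect test a b).2 ≤ (K + 4) * e + 1 := by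
  induction e generalizing a b with
  | zero =>
    rw [bisect, if_neg (by rw [pow_zero] at hab; omega)]
    simp
  | succ e ih =>
    rw [pow_succ] at hab
    have hK := h ((a + b) / 2)
    rw [bisect]
    split_ifs
    · have := ih a ((a + b) / 2) (by omega)
      simp only
      linarith
    · have := ih ((a + b) / 2 + 1) b (by omega)
      simp only
      linarith
    · simp

section Search

variable {n m : ℕ} {I : Jobs n} {S S' : State I} {F : MaxFlowAlg} {f : ℕ → ℕ} {δ α v : ℝ} {c : ℕ}

/-- The binary search rounds the critical speed up to a multiple of `δ`. -/
theorem search_fst (hm : ∀ j, S.mach j ≤ m) (hδ : 0 < δ) (hv : S.IsCritSpeed m v)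
    (hne : S.jobs.Nonempty) (hub : v ≤ S.ub) : (search F δ S).1 = ⌈v / δ⌉₊ * δ := by
  have hlb := hv.loaded.lb_le hv.pos.le hne
  obtain ⟨i, hi⟩ := hne
  have hlb0 : 0 < S.lb := (I.den_pos i).trans_le (State.den_le_lb hi)
  have h1 := bisect_fst (test := fun k => wapTest F S (k * δ)) (k := ⌈v / δ⌉₊) ⌈S.lb / δ⌉₊
    ⌈S.ub / δ⌉₊ (Nat.ceil_mono (by gcongr)) (Nat.ceil_mono (by gcongr)) fun l hl => by
      have hl0 : 0 < l := (Nat.ceil_pos.2 (div_pos hlb0 hδ)).trans_le hl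
      have hlδ : 0 < (l : ℝ) * δ := by positivity
      change (wapTest F S (l * δ)).1 = true ↔ _
      rw [State.wapTest_iff F hlδ, hv.loaded_iff F hm hlδ, Nat.ceil_le, div_le_iff₀ hδ]
  change ((bisect _ _ _).1 : ℝ) * δ = _
  rw [h1]

theorem search_spec (hm : ∀ j, S.mach j ≤ m) (hδ : 0 < δ) (hv : S.IsCritSpeed m v)
    (hne : S.jobs.Nonempty) (hub : v ≤ S.ub) :
    v ≤ (search F δ S).1 ∧ (search F δ S).1 < v + δ ∧
      ((∃ k : ℕ, v = k * δ) → (search F δ S).1 = v) := by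
  rw [search_fst hm hδ hv hne hub]
  refine ⟨?_, ?_, ?_⟩
  · rw [← div_le_iff₀ hδ]
    exact Nat.le_ceil _
  · have := Nat.ceil_lt_add_one (div_pos hv.pos hδ).le
    rw [← lt_div_iff₀ hδ, add_div, div_self hδ.ne']
    exact this
  · rintro ⟨k, rfl⟩
    rw [mul_div_cancel_right₀ _ hδ.ne', Nat.ceil_natCast]

/-! ### The running time -/

lemma graphSize_le : graphSize n I.L ≤ 3 * n + 2 * n ^ 2 := by
  have h1 := I.L_le
  have h2 := Nat.mul_le_mul_left n h1
  rw [graphSize]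
  nlinarith

lemma wapTest_snd_le (hF : F.RunsIn f) (hv : 0 ≤ v) :
    (wapTest F S v).2 ≤ 5 * n + 2 * n ^ 2 + f n := by
  have h1 := graphSize_le (I := I)
  have h2 := hF n I.L _ (S.net_nonneg hv) I.L_le
  simp only [wapTest]
  omega

lemma le_self_of_sq_le {x : ℕ} (h : n ^ 2 ≤ x) : n ≤ x :=
  (Nat.le_self_pow two_ne_zero n).trans h

lemma search_snd_le (hF : F.RunsIn f) (hδ : 0 ≤ δ) (hf : n ^ 2 ≤ f n) :
    (search F δ S).2 ≤
      (8 * f n + 4) * (Nat.log 2 (⌈S.ub / δ⌉₊ - ⌈S.lb / δ⌉₊) + 1) + 5 := by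
  have hn := le_self_of_sq_le hf
  have h1 := bisect_snd_le (test := fun k => wapTest F S (k * δ)) (K := 8 * f n)
    (fun l => (wapTest_snd_le hF (by positivity)).trans (by omega))
    (Nat.log 2 (⌈S.ub / δ⌉₊ - ⌈S.lb / δ⌉₊) + 1) ⌈S.lb / δ⌉₊ ⌈S.ub / δ⌉₊
    (Nat.lt_pow_succ_log_self one_lt_two _)
  simp only [search]
  omega

lemma ciInf_den_le (i : Fin n) : ⨅ i, I.den i ≤ I.den i :=
  ciInf_le (Set.finite_range I.den).bddBelow i

lemma speedRange_nonneg (hn : 0 < n) (hδ : 0 < δ) : 0 ≤ speedRange I δ :=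
  div_nonneg (sub_nonneg.2 ((ciInf_den_le ⟨0, hn⟩).trans (I.den_le_sUB _))) hδ.le

lemma Invariant.range_le (h : Invariant m α S) (hδ : 0 < δ) (hne : S.jobs.Nonempty) :
    ((⌈S.ub / δ⌉₊ - ⌈S.lb / δ⌉₊ : ℕ) : ℝ) ≤ speedRange I δ + 1 := by
  have hlb := h.loaded.lb_le h.ub_pos.le hne
  obtain ⟨i, hi⟩ := hne
  have h1 : ⌈S.lb / δ⌉₊ ≤ ⌈S.ub / δ⌉₊ := Nat.ceil_mono (by gcongr)
  rw [Nat.cast_sub h1]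
  have h2 := Nat.ceil_lt_add_one (div_pos h.ub_pos hδ).le
  have h3 := Nat.le_ceil (S.lb / δ)
  have h4 : S.ub / δ ≤ I.sUB / δ := div_le_div_of_nonneg_right h.ub_le hδ.le
  have h5 : (⨅ i, I.den i) / δ ≤ S.lb / δ :=
    div_le_div_of_nonneg_right ((ciInf_den_le i).trans (State.den_le_lb hi)) hδ.le
  rw [speedRange, sub_div]
  linarith

/-- The number of tests of a binary search in a range of length `d`. -/
lemma log_two_le {d : ℕ} {P : ℝ} (hP : 0 ≤ P) (hd : (d : ℝ) ≤ P + 1) :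
    ((Nat.log 2 d + 1 : ℕ) : ℝ) ≤ 3 * Real.log (2 + P) := by
  have hlog2 := Real.log_two_gt_d9
  have h2 : Real.log 2 ≤ Real.log (2 + P) := Real.log_le_log (by norm_num) (by linarith)
  have h1 : (Nat.log 2 d : ℝ) * Real.log 2 ≤ Real.log (2 + P) := by
    rcases Nat.eq_zero_or_pos d with rfl | hpos
    · simp only [Nat.log_zero_right, Nat.cast_zero, zero_mul]
      linarith
    · rw [← Real.log_pow]
      refine Real.log_le_log (by positivity) ?_
      have h3 : ((2 ^ Nat.log 2 d : ℕ) : ℝ) ≤ d := by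
        exact_mod_cast Nat.pow_log_le_self 2 hpos.ne'
      push_cast at h3
      linarith
  push_cast
  have h4 : 0 ≤ (Nat.log 2 d : ℝ) := Nat.cast_nonneg _
  nlinarith

lemma Step.time_le (hF : F.RunsIn f) (hn : 0 < n) (hδ : 0 < δ) (hf : n ^ 2 ≤ f n)
    (hinv : Invariant m α S) (h : Step F m δ S S' c) :
    (c : ℝ) ≤ 140 * f n * Real.log (2 + speedRange I δ) := by
  obtain ⟨hne, v, v', X, -, hv', -, -, -, -, rfl⟩ := h
  have hs := search_snd_le (S := S) hF hδ.le hf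
  have hlog := log_two_le (speedRange_nonneg hn hδ) (hinv.range_le hδ hne)
  set e := Nat.log 2 (⌈S.ub / δ⌉₊ - ⌈S.lb / δ⌉₊) + 1
  have he : 1 ≤ e := Nat.le_add_left 1 _
  have hg := graphSize_le (I := I)
  have hL := I.L_le
  have hnL := Nat.mul_le_mul_left n hL
  have ht := hF n I.L _ (S.net_nonneg hv'.le) I.L_le
  have hfn := le_self_of_sq_le hf
  have hnL' : n * (2 * n) = 2 * n ^ 2 := by ring
  have h1 : (search F δ S).2
      + (graphSize n I.L + F.time (S.net v') + 2 * graphSize n I.L + (n + I.L + 2))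
      + (2 * n + n * I.L + I.L) + n ≤ (8 * f n + 4) * e + 5 + 28 * f n := by omega
  have h2 : (8 * f n + 4) * e + 5 + 28 * f n ≤ 45 * f n * e := by
    have h3 : 1 ≤ f n := hn.trans_le hfn
    have h4 : f n ≤ f n * e := Nat.le_mul_of_pos_right _ he
    have h5 : e ≤ f n * e := Nat.le_mul_of_pos_left _ h3
    nlinarith
  calc ((_ : ℕ) : ℝ) ≤ ((45 * f n * e : ℕ) : ℝ) := by exact_mod_cast h1.trans h2
    _ = 45 * f n * (e : ℝ) := by push_cast; ring
    _ ≤ 45 * f n * (3 * Real.log (2 + speedRange I δ)) := by gcongr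
    _ ≤ 140 * f n * Real.log (2 + speedRange I δ) := by
      have : 0 ≤ f n * Real.log (2 + speedRange I δ) := by
        have := Real.log_nonneg (x := 2 + speedRange I δ)
          (by linarith [speedRange_nonneg (I := I) hn hδ])
        positivity
      linarith

theorem Run.time_le (hF : F.RunsIn f) (hn : 0 < n) (hm : 0 < m) (hδ : 0 < δ) (hf : n ^ 2 ≤ f n)
    (h : Run F m δ (init I m) S c) :
    (c : ℝ) ≤ 140 * f n * Real.log (2 + speedRange I δ) * (n - S.jobs.card) := by
  induction h with
  | refl => simp [init]
  | @tail S' S'' c c' hrun hstep ih =>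
    have hinv : Invariant m 1 S' := hrun.invariant hn hm one_pos
    have h1 := hstep.time_le hF hn hδ hf hinv
    have h2 : (S''.jobs.card : ℝ) + 1 ≤ S'.jobs.card := by
      exact_mod_cast Finset.card_lt_card (hstep.jobs_ssubset hinv.mach_le)
    have h3 : 0 ≤ 140 * f n * Real.log (2 + speedRange I δ) := (Nat.cast_nonneg _).trans h1
    push_cast
    nlinarith

lemma initTime_add_outputTime_le (hF : F.RunsIn f) (hf : n ^ 2 ≤ f n)
    (hs : ∀ i, 0 < S.speed i) : initTime I + outputTime F m S ≤ 33 * f n := by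
  have hg := graphSize_le (I := I)
  have hL := I.L_le
  have hnL := Nat.mul_le_mul_left n hL
  have ht := hF n I.L _ (finalNet_nonneg (I := I) (m := m) hs) I.L_le
  have hfn := le_self_of_sq_le hf
  have hnL' : n * (2 * n) = 2 * n ^ 2 := by ring
  have hnn : 2 * n * (2 * n) = 4 * n ^ 2 := by ring
  rw [initTime, outputTime]
  omega

end Search

end BAL

end

/-- The algorithm never gets stuck, every iteration removes a job, the binary search locates the
critical speed with the desired accuracy, and every terminated run outputs an optimal schedule and
takes total time `O(n f(n) log P)`, with an absolute constant. -/
theorem theorem1 :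
    ∃ C : ℝ, 0 < C ∧
      ∀ (F : BAL.MaxFlowAlg) (f : ℕ → ℕ), F.RunsIn f →
      ∀ (n m : ℕ) (I : BAL.Jobs n) (α δ : ℝ), 0 < n → 0 < m → 1 < α → 0 < δ → n ^ 2 ≤ f n →
        (∀ (S : BAL.State I) (c : ℕ), BAL.Run F m δ (BAL.init I m) S c → S.jobs.Nonempty →
          (∃ v, S.IsCritSpeed m v ∧ S.lb ≤ v ∧ v ≤ S.ub ∧
            v ≤ (BAL.search F δ S).1 ∧ (BAL.search F δ S).1 < v + δ ∧
            ((∃ k : ℕ, v = k * δ) → (BAL.search F δ S).1 = v)) ∧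
          (∃ S' c', BAL.Step F m δ S S' c') ∧
          (∀ S' c', BAL.Step F m δ S S' c' → S'.jobs ⊂ S.jobs)) ∧
        (∀ (S : BAL.State I) (c : ℕ), BAL.Run F m δ (BAL.init I m) S c → S.jobs = ∅ →
          (BAL.output F m S).Optimal I α ∧
          ((BAL.initTime I + c + BAL.outputTime F m S : ℕ) : ℝ) ≤
            C * n * f n * Real.log (2 + BAL.speedRange I δ)) := by

  refine ⟨240, by norm_num, fun F f hF n m I α δ hn hm hα hδ hf => ⟨fun S c hrun hne => ?_,
    fun S c hrun he => ?_⟩⟩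
  · have hinv : BAL.Invariant m α S := hrun.invariant hn hm (by linarith)
    obtain ⟨v, hv⟩ := hinv.loaded.exists_isCritSpeed F hinv.mach_le hne
    have hub := hv.le_of_loaded F hinv.mach_le hinv.ub_pos hinv.loaded
    exact ⟨⟨v, hv, hv.loaded.lb_le hv.pos.le hne, hub,
      BAL.search_spec hinv.mach_le hδ hv hne hub⟩,
      BAL.exists_step hinv.mach_le hinv.loaded hne,
      fun S' c' h => h.jobs_ssubset hinv.mach_le⟩
  · have hinv : BAL.Invariant m α S := hrun.invariant hn hm (by linarith)
    refine ⟨hinv.output_optimal hα he, ?_⟩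
    have h1 := hrun.time_le hF hn hm hδ hf
    have h2 : ((BAL.initTime I + BAL.outputTime F m S : ℕ) : ℝ) ≤ 33 * f n := by
      exact_mod_cast BAL.initTime_add_outputTime_le hF hf fun i =>
        hinv.speed_pos i (by simp [he])
    have hn1 : (1 : ℝ) ≤ n := by exact_mod_cast hn
    have h3 : (1 : ℝ) / 2 ≤ Real.log (2 + BAL.speedRange I δ) := by
      have := Real.log_two_gt_d9
      have h4 : Real.log 2 ≤ Real.log (2 + BAL.speedRange I δ) :=
        Real.log_le_log (by norm_num) (by linarith [BAL.speedRange_nonneg (I := I) hn hδ])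
      linarith
    have h5 : (1 : ℝ) / 2 ≤ n * Real.log (2 + BAL.speedRange I δ) := by nlinarith
    have h6 : (f n : ℝ) * (1 / 2) ≤ f n * (n * Real.log (2 + BAL.speedRange I δ)) :=
      mul_le_mul_of_nonneg_left h5 (Nat.cast_nonneg _)
    rw [he, Finset.card_empty, Nat.cast_zero, sub_zero] at h1
    push_cast at h2 ⊢
    linarith
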